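/- Let $\{\lambda_n\}_{n\ge 0}$ be nonnegative numbers with $\sum_{n\ge0}\lambda_n=1$ and $\sup_{n\ge 0}\gamma^{-n}\lambda_n<\infty$ for some $\gamma\in(0,1)$. Let $\{\xi_n\}_{n\ge1}$ be i.i.d. nonnegative random variables whose Laplace transform $\phi(t)=\mathbb E(e^{-t\xi_1})$ satisfies $$1-t^{\alpha}\le \phi(t)\le c(1+t)^{-\beta},\qquad t\ge 0,$$ for some constants $0<\alpha\le 1$, $\beta>0$, $c>0$. Let $\omega_0>0$ be a constant and $$\omega_n=\Big(1-\sum_{k=1}^n\lambda_{n-k}\Big)\omega_0+\sum_{k=1}^n\lambda_{n-k}\xi_k,\qquad n\ge 1.$$ Let $F$ be a function with $0\le F(s)<\infty$ for $s>0$ that is the Laplace transform of a nonnegative function $f$ on $(0,\infty)$ of at most polynomial growth at infinity: $F(s)=\int_0^\infty e^{-st}f(t)\,dt$ for $s>0$, and $f(t)\le C(1+t)^m$ for $t\ge 1$, for some constants $C>0$, $m\ge0$. Let $(f*f)(t)=\int_0^t f(s)f(t-s)\,ds$ and $$V=\int_0^\infty (f*f)(t)\prod_{k=0}^\infty\phi(\lambda_k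 t)\,dt .$$ If only finitely many of the $\lambda_n$ are nonzero, assume in addition that $V<\infty$. Let $\{\eta_n\}_{n\ge1}$ be random variables such that, for every $n\ge 0$, $\eta_{n+1}$ is independent of $\{(\xi_k,\eta_k):1\le k\le n\}$, and such that $\mathbb E(\eta_n)=0$ for all $n\ge 1$, $\lim_{n\to\infty}\mathbb E(\eta_n^2)=1$, and $\sup_{n\ge1}\mathbb E(|\eta_n|^p)<\infty$ for some $p>2$. Then $V<\infty$ and $$\frac1{\sqrt N}\sum_{k=1}^N F(\omega_{k-1})\,\eta_k\longrightarrow \mathcal N(0,V)\quad\text{in distribution as }N\to\infty,$$ where $\mathcal N(0,V)$ is the normal distribution with mean $0$ and variance $V$ (the point mass at $0$ if $V=0$). -/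

import Mathlib

open MeasureTheory ProbabilityTheory Filter Topology

noncomputable section

/-- The Laplace transform `t ↦ 𝔼[exp (-t X)]` of a real random variable `X`. -/
def rvLaplace {Ω : Type*} [MeasurableSpace Ω] (P : Measure Ω) (X : Ω → ℝ) (t : ℝ) : ℝ :=
  ∫ w, Real.exp (-t * X w) ∂P

/-- The Laplace transform `s ↦ ∫₀^∞ exp (-s t) f(t) dt` of a function `f` on `(0, ∞)`. -/
def laplaceTransform (f : ℝ → ℝ) (s : ℝ) : ℝ :=
  ∫ t in Set.Ioi (0 : ℝ), Real.exp (-s * t) * f t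

/-- `F` is, on `(0, ∞)`, a finite nonnegative function which is the Laplace transform of a
nonnegative function `f` on `(0, ∞)` with at most polynomial growth at infinity. The field
`integrable` says that the integral defining the Laplace transform converges at every `s > 0`. -/
structure IsPolyLaplace (F f : ℝ → ℝ) : Prop where
  nonneg_left : ∀ s : ℝ, 0 < s → 0 ≤ F s
  nonneg_right : ∀ t : ℝ, 0 < t → 0 ≤ f t
  integrable : ∀ s : ℝ, 0 < s →
    IntegrableOn (fun t : ℝ => Real.exp (-s * t) * f t) (Set.Ioi 0)
  eq_laplace : ∀ s : ℝ, 0 < s → F s = laplaceTransform f s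
  growth : ∃ c : ℝ, 0 < c ∧ ∃ m : ℝ, 0 ≤ m ∧ ∀ t : ℝ, 1 ≤ t → f t ≤ c * (1 + t) ^ m

/-- The self-convolution `(f ∗ f)(t) = ∫₀ᵗ f(s) f(t - s) ds` of a function on `(0, ∞)`. -/
def selfConv (f : ℝ → ℝ) (t : ℝ) : ℝ := ∫ s in (0 : ℝ)..t, f s * f (t - s)

/-- The moving average
`ω_n = (1 - ∑_{k=1}^n λ_{n-k}) ω₀ + ∑_{k=1}^n λ_{n-k} ξ_k`; for `n = 0` this is `ω₀`. -/
def movingAverage {Ω : Type*} (lam : ℕ → ℝ) (ω₀ : ℝ) (ξ : ℕ → Ω → ℝ) (n : ℕ) (w : Ω) : ℝ :=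
  (1 - ∑ k ∈ Finset.Icc 1 n, lam (n - k)) * ω₀ + ∑ k ∈ Finset.Icc 1 n, lam (n - k) * ξ k w

/-- The integrand `(f ∗ f)(t) ∏_{k ≥ 0} φ(λ_k t)` of the limiting variance. -/
def varianceIntegrand (f φ : ℝ → ℝ) (lam : ℕ → ℝ) (t : ℝ) : ℝ :=
  selfConv f t * ∏' k : ℕ, φ (lam k * t)

/-- The limiting variance `∫₀^∞ (f ∗ f)(t) ∏_{k ≥ 0} φ(λ_k t) dt`. -/
def limitVariance (f φ : ℝ → ℝ) (lam : ℕ → ℝ) : ℝ :=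
  ∫ t in Set.Ioi (0 : ℝ), varianceIntegrand f φ lam t

end

/-!
Let `Tₙ = ∑_{j < n} (F(ωⱼ)² / n) E ηⱼ₊₁²` be the predictable variation of the normalised sum `Sₙ`.
If the weights `F(ωⱼ)` are bounded, peeling off one innovation at a time shows that
`E exp(iuSₙ + u²Tₙ/2) → 1`: each factor deviates from `1` by a third-order quantity. So the limit
law of `Sₙ` is `N(0, V)` as soon as `Tₙ → V` in `L¹`.

The limit of `E F(ωₙ)²` comes from `F(s)² = ∫ (f*f)(t) e^{-st} dt`: the Laplace transform
`E e^{-tωₙ}` is a product over the noise that converges to `∏ φ(λₖ t)`, and the power decay of `φ`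
supplies the domination. The weak law for `Tₙ` is a covariance estimate: since `∑ (1 - φ(λₖ)) < ∞`,
noise at large lags hardly changes `e^{-ω}`, so `ωₙ` and `ωₙ₊ₘ` are nearly independent for
large `m`.

As `F` may be unbounded at `0`, this is applied to `F(ε + ·)`, whose variance tends to `V` as
`ε → 0`, and the two sums are compared in `L²`.
-/

section Elementary

theorem norm_exp_mul_I_sub_quadratic_le {q : ℝ} (hq2 : 2 ≤ q) (hq3 : q ≤ 3) (x : ℝ) :
    ‖Complex.exp (x * Complex.I) - (1 + x * Complex.I - x ^ 2 / 2)‖ ≤ 4 * |x| ^ q := by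
  rcases le_or_gt |x| 1 with hx | hx
  · have taylor : ‖Complex.exp (x * Complex.I) - (1 + x * Complex.I - x ^ 2 / 2)‖
        ≤ |x| ^ 3 * (4 * (6 * 3)⁻¹) := by
      have h := Complex.exp_bound (x := x * Complex.I) (by simpa using hx) (n := 3) (by norm_num)
      have hsum : ∑ m ∈ Finset.range 3, ((x : ℂ) * Complex.I) ^ m / (m.factorial : ℂ)
          = 1 + x * Complex.I - x ^ 2 / 2 := by
        simp [Finset.sum_range_succ, mul_pow]
        ring
      rw [hsum] at h
      norm_num [Nat.factorial] at h ⊢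
      exact h
    have hcube : |x| ^ 3 ≤ |x| ^ q := by
      rw [← Real.rpow_natCast]
      exact Real.rpow_le_rpow_of_exponent_ge' (abs_nonneg x) hx (by linarith)
        (by exact_mod_cast hq3)
    linarith [pow_nonneg (abs_nonneg x) 3]
  · have hsq : |x| ^ 2 ≤ |x| ^ q := by
      rw [← Real.rpow_natCast]
      exact Real.rpow_le_rpow_of_exponent_le hx.le (by exact_mod_cast hq2)
    have hpoly : ‖(1 + x * Complex.I - x ^ 2 / 2 : ℂ)‖ ≤ 1 + |x| + |x| ^ 2 / 2 := by
      refine (norm_sub_le _ _).trans (add_le_add ((norm_add_le _ _).trans ?_) ?_) <;> simp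
    refine (norm_sub_le _ _).trans ?_
    rw [Complex.norm_exp_ofReal_mul_I]
    nlinarith

theorem abs_exp_neg_sub_one_sub_le_rpow {r : ℝ} (hr1 : 1 ≤ r) (hr2 : r ≤ 2) {y : ℝ} (hy : 0 ≤ y) :
    |Real.exp (-y) - (1 - y)| ≤ y ^ r := by
  rcases le_or_gt y 1 with hy1 | hy1
  · calc |Real.exp (-y) - (1 - y)| = |Real.exp (-y) - 1 - -y| := by ring_nf
      _ ≤ (-y) ^ 2 := Real.abs_exp_sub_one_sub_id_le (by rwa [abs_neg, abs_of_nonneg hy])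
      _ = y ^ (2 : ℝ) := by rw [neg_sq, Real.rpow_two]
      _ ≤ y ^ r := Real.rpow_le_rpow_of_exponent_ge' hy hy1 (by linarith) hr2
  · have hself : y ≤ y ^ r := Real.self_le_rpow_of_one_le hy1.le hr1
    have hexp : Real.exp (-y) ≤ 1 := Real.exp_le_one_iff.2 (by linarith)
    rw [abs_le]
    constructor <;> linarith [Real.exp_pos (-y)]

theorem abs_exp_sub_exp_le {a b R : ℝ} (ha : a ≤ R) (hb : b ≤ R) :
    |Real.exp a - Real.exp b| ≤ Real.exp R * |a - b| := by
  simpa only [Real.norm_eq_abs, abs_sub_comm] using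
    (convex_Iic R).norm_image_sub_le_of_norm_deriv_le (f := Real.exp) (C := Real.exp R)
      (fun x _ => Real.differentiableAt_exp) (fun x hx => by simpa using hx) hb ha

theorem norm_exp_mul_I_sub_exp_mul_I_le (a b : ℝ) :
    ‖Complex.exp (a * Complex.I) - Complex.exp (b * Complex.I)‖ ≤ |a - b| := by
  have h : Complex.exp (a * Complex.I) - Complex.exp (b * Complex.I)
      = Complex.exp (b * Complex.I) * (Complex.exp (Complex.I * (a - b : ℝ)) - 1) := by
    rw [mul_sub, ← Complex.exp_add, mul_one]
    congr 2
    push_cast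
    ring
  rw [h, norm_mul, Complex.norm_exp_ofReal_mul_I, one_mul]
  exact Real.norm_exp_I_mul_ofReal_sub_one_le

end Elementary

section GaussianApproximation

variable {Ω : Type*} [mΩ : MeasurableSpace Ω] {P : Measure Ω} [IsProbabilityMeasure P]

theorem integrable_exp_mul_I {X : Ω → ℝ} (hX : Measurable X) :
    Integrable (fun w => Complex.exp (X w * Complex.I)) P :=
  Integrable.of_bound (by fun_prop) 1 (ae_of_all _ fun w => (Complex.norm_exp_ofReal_mul_I _).le)

theorem integral_sq_rpow_le_integral_rpow {e : Ω → ℝ} {q : ℝ} (hq : 2 ≤ q) (he : MemLp e 2 P)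
    (hint : Integrable (fun w => |e w| ^ q) P) :
    (∫ w, e w ^ 2 ∂P) ^ (q / 2) ≤ ∫ w, |e w| ^ q ∂P := by
  have hpow : (fun w => |e w| ^ q) = fun w => (e w ^ 2) ^ (q / 2) := by
    ext w
    rw [← sq_abs, ← Real.rpow_natCast_mul (abs_nonneg _)]
    congr 1
    push_cast
    ring
  rw [hpow] at hint ⊢
  exact (convexOn_rpow (by linarith)).map_integral_le
    (Real.continuous_rpow_const (by linarith)).continuousOn isClosed_Ici
    (ae_of_all _ fun w => Set.mem_Ici.2 (sq_nonneg (e w))) he.integrable_sq hint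

variable {e : Ω → ℝ} {q M : ℝ}

theorem integral_quadratic_of_integral_eq_zero (h2 : MemLp e 2 P) (hmean : ∫ w, e w ∂P = 0)
    (s : ℝ) :
    Integrable (fun w => 1 + ((s * e w : ℝ) : ℂ) * Complex.I - ((s * e w : ℝ) : ℂ) ^ 2 / 2) P ∧
    ∫ w, (1 + ((s * e w : ℝ) : ℂ) * Complex.I - ((s * e w : ℝ) : ℂ) ^ 2 / 2) ∂P
      = ((1 - s ^ 2 * (∫ w, e w ^ 2 ∂P) / 2 : ℝ) : ℂ) := by
  have linear_int : Integrable (fun w => ((s * e w : ℝ) : ℂ) * Complex.I) P :=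
    (((h2.integrable one_le_two).const_mul s).ofReal).mul_const _
  have square_eq : (fun w => ((s * e w : ℝ) : ℂ) ^ 2 / 2)
      = fun w => ((s ^ 2 / 2 * e w ^ 2 : ℝ) : ℂ) := by
    ext w
    push_cast
    ring
  have square_int : Integrable (fun w => ((s * e w : ℝ) : ℂ) ^ 2 / 2) P := by
    rw [square_eq]
    exact (h2.integrable_sq.const_mul _).ofReal
  have affine_int := (integrable_const (1 : ℂ)).add linear_int
  refine ⟨affine_int.sub square_int, ?_⟩
  rw [integral_sub (f := fun w => 1 + ((s * e w : ℝ) : ℂ) * Complex.I) affine_int square_int,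
    integral_add (integrable_const 1) linear_int, integral_mul_const, integral_complex_ofReal,
    integral_const_mul, hmean, square_eq, integral_complex_ofReal, integral_const_mul]
  simp
  ring

theorem norm_integral_exp_mul_I_sub_gaussian_le (he : Measurable e) (hq2 : 2 ≤ q) (hq3 : q ≤ 3)
    (h2 : MemLp e 2 P) (hmean : ∫ w, e w ∂P = 0) (hint : Integrable (fun w => |e w| ^ q) P)
    (hM : ∫ w, |e w| ^ q ∂P ≤ M) (s : ℝ) :
    ‖∫ w, Complex.exp ((s * e w : ℝ) * Complex.I) ∂P
        - (Real.exp (-(s ^ 2 * (∫ w, e w ^ 2 ∂P) / 2)) : ℝ)‖ ≤ 5 * (|s| ^ q * M) := by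
  set v := ∫ w, e w ^ 2 ∂P
  have v_nonneg : 0 ≤ v := integral_nonneg fun w => sq_nonneg _
  obtain ⟨quad_int, quad_eq⟩ := integral_quadratic_of_integral_eq_zero h2 hmean s
  have charFun_le : ‖∫ w, Complex.exp ((s * e w : ℝ) * Complex.I) ∂P
      - ((1 - s ^ 2 * v / 2 : ℝ) : ℂ)‖ ≤ 4 * (|s| ^ q * M) := by
    rw [← quad_eq, ← integral_sub (integrable_exp_mul_I (he.const_mul s)) quad_int]
    calc _ ≤ ∫ w, 4 * |s| ^ q * |e w| ^ q ∂P := by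
          refine norm_integral_le_of_norm_le (hint.const_mul _) (ae_of_all _ fun w => ?_)
          refine (norm_exp_mul_I_sub_quadratic_le hq2 hq3 _).trans_eq ?_
          rw [abs_mul, Real.mul_rpow (abs_nonneg _) (abs_nonneg _), mul_assoc]
      _ = 4 * (|s| ^ q * ∫ w, |e w| ^ q ∂P) := by rw [integral_const_mul, mul_assoc]
      _ ≤ _ := by gcongr
  have gaussian_le : ‖((1 - s ^ 2 * v / 2 : ℝ) : ℂ) - (Real.exp (-(s ^ 2 * v / 2)) : ℝ)‖
      ≤ |s| ^ q * M := by
    rw [← Complex.ofReal_sub, Complex.norm_real, Real.norm_eq_abs, abs_sub_comm]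
    calc _ ≤ (s ^ 2 * v / 2) ^ (q / 2) :=
          abs_exp_neg_sub_one_sub_le_rpow (by linarith) (by linarith) (by positivity)
      _ ≤ (s ^ 2 * v) ^ (q / 2) := by
          gcongr
          exact half_le_self (by positivity)
      _ = |s| ^ q * v ^ (q / 2) := by
          rw [Real.mul_rpow (sq_nonneg s) v_nonneg, ← sq_abs,
            ← Real.rpow_natCast_mul (abs_nonneg _)]
          congr 2
          push_cast
          ring
      _ ≤ |s| ^ q * M := by
          gcongr
          exact (integral_sq_rpow_le_integral_rpow hq2 h2 hint).trans hM
  refine (norm_sub_le_norm_sub_add_norm_sub _ ((1 - s ^ 2 * v / 2 : ℝ) : ℂ) _).trans ?_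
  linarith

theorem integral_comp_prodMk_of_indepFun {α β E : Type*} [MeasurableSpace α] [MeasurableSpace β]
    [NormedAddCommGroup E] [NormedSpace ℝ E] {Y : Ω → α} {Z : Ω → β} (hind : IndepFun Y Z P)
    (hY : Measurable Y) (hZ : Measurable Z) {g : α × β → E} (hg : StronglyMeasurable g)
    (hint : Integrable (fun w => g (Y w, Z w)) P) :
    ∫ w, g (Y w, Z w) ∂P = ∫ w, (∫ w', g (Y w, Z w') ∂P) ∂P := by
  have hmap := (indepFun_iff_map_prod_eq_prod_map_map hY.aemeasurable hZ.aemeasurable).1 hind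
  have hi : Integrable g ((P.map Y).prod (P.map Z)) := by
    rw [← hmap]
    exact (integrable_map_measure hg.aestronglyMeasurable (by fun_prop)).2 hint
  calc ∫ w, g (Y w, Z w) ∂P = ∫ z, g z ∂(P.map fun w => (Y w, Z w)) :=
        (integral_map (by fun_prop) hg.aestronglyMeasurable).symm
    _ = ∫ y, ∫ x, g (y, x) ∂(P.map Z) ∂(P.map Y) := by rw [hmap, integral_prod _ hi]
    _ = ∫ w, ∫ x, g (Y w, x) ∂(P.map Z) ∂P :=
        integral_map hY.aemeasurable hi.integral_prod_left.aestronglyMeasurable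
    _ = ∫ w, (∫ w', g (Y w, Z w') ∂P) ∂P := by
        congr 1 with w
        exact integral_map (f := fun x => g (Y w, x)) hZ.aemeasurable
          (hg.comp_measurable measurable_prodMk_left).aestronglyMeasurable

theorem norm_integral_mul_exp_sub_gaussian_le {Z : Ω → ℂ} {X : Ω → ℝ} {A K : ℝ}
    (hZ : Measurable Z) (hX : Measurable X) (he : Measurable e)
    (hind : IndepFun (fun w => (Z w, X w)) e P) (hq2 : 2 ≤ q) (hq3 : q ≤ 3) (h2 : MemLp e 2 P)
    (hmean : ∫ w, e w ∂P = 0) (hint : Integrable (fun w => |e w| ^ q) P)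
    (hM : ∫ w, |e w| ^ q ∂P ≤ M) (hA : ∀ w, ‖Z w‖ ≤ A) (hK : ∀ w, |X w| ≤ K) :
    ‖∫ w, Z w * (Complex.exp ((X w * e w : ℝ) * Complex.I)
        - (Real.exp (-(X w ^ 2 * (∫ w, e w ^ 2 ∂P) / 2)) : ℝ)) ∂P‖ ≤ A * (5 * (K ^ q * M)) := by
  set v := ∫ w, e w ^ 2 ∂P
  have v_nonneg : 0 ≤ v := integral_nonneg fun w => sq_nonneg _
  have M_nonneg : 0 ≤ M := (integral_nonneg fun w => by positivity).trans hM
  obtain ⟨w₀⟩ := P.nonempty_of_neZero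
  have A_nonneg : 0 ≤ A := (norm_nonneg _).trans (hA w₀)
  let g : (ℂ × ℝ) × ℝ → ℂ := fun z => z.1.1 * (Complex.exp ((z.1.2 * z.2 : ℝ) * Complex.I)
        - (Real.exp (-(z.1.2 ^ 2 * v / 2)) : ℝ))
  have g_int : Integrable (fun w => g ((Z w, X w), e w)) P := by
    refine Integrable.of_bound (by fun_prop) (A * 2) (ae_of_all _ fun w => ?_)
    have exp_le : ‖((Real.exp (-(X w ^ 2 * v / 2)) : ℝ) : ℂ)‖ ≤ 1 := by
      rw [Complex.norm_real, Real.norm_eq_abs, Real.abs_exp, Real.exp_le_one_iff]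
      exact neg_nonpos.2 (div_nonneg (mul_nonneg (sq_nonneg _) v_nonneg) zero_le_two)
    rw [norm_mul]
    refine mul_le_mul (hA w) ((norm_sub_le _ _).trans ?_) (norm_nonneg _) A_nonneg
    rw [Complex.norm_exp_ofReal_mul_I]
    linarith
  have freeze := integral_comp_prodMk_of_indepFun hind (hZ.prodMk hX) he (g := g)
    (Measurable.stronglyMeasurable (by fun_prop)) g_int
  change ‖∫ w, g ((Z w, X w), e w) ∂P‖ ≤ _
  rw [freeze]
  refine (norm_integral_le_of_norm_le_const (C := A * (5 * (K ^ q * M)))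
    (ae_of_all _ fun w => ?_)).trans_eq (by rw [probReal_univ, mul_one])
  simp only [g]
  rw [integral_const_mul, norm_mul, integral_sub (integrable_exp_mul_I (he.const_mul (X w)))
    (integrable_const _), integral_const, probReal_univ, one_smul]
  refine mul_le_mul (hA w) ?_ (norm_nonneg _) A_nonneg
  refine (norm_integral_exp_mul_I_sub_gaussian_le he hq2 hq3 h2 hmean hint hM (X w)).trans ?_
  gcongr
  exact hK w

end GaussianApproximation

theorem integral_abs_le_sqrt_integral_sq {Ω : Type*} [MeasurableSpace Ω] {P : Measure Ω}
    [IsProbabilityMeasure P] {g : Ω → ℝ} (hg : MemLp g 2 P) :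
    ∫ w, |g w| ∂P ≤ √(∫ w, g w ^ 2 ∂P) := by
  refine Real.le_sqrt_of_sq_le ?_
  have h := variance_nonneg |g| P
  rw [variance_eq_sub hg.abs] at h
  simp only [Pi.pow_apply, Pi.abs_apply, sq_abs] at h
  linarith

section WeightedSums

variable {Ω : Type*} {X e : ℕ → Ω → ℝ} {q M K : ℝ}

/-- The sum `∑_{i < k} X_i e_i` of innovations with predictable weights, a martingale in `k`. -/
def weightedSum (X e : ℕ → Ω → ℝ) (k : ℕ) (w : Ω) : ℝ :=
  ∑ i ∈ Finset.range k, X i w * e i w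

theorem weightedSum_mul_left (s : ℝ) (k : ℕ) (w : Ω) :
    weightedSum (fun i w => s * X i w) e k w = s * weightedSum X e k w := by
  simp only [weightedSum, Finset.mul_sum, mul_assoc]

variable [mΩ : MeasurableSpace Ω] {P : Measure Ω} {𝓕 : Filtration ℕ mΩ}

/-- A sequence of centred, square integrable innovations for the filtration `𝓕`: `e i` is revealed
at time `i + 1` and is independent of the past `𝓕 i`. -/
structure IsInnovation (𝓕 : Filtration ℕ mΩ) (P : Measure Ω) (e : ℕ → Ω → ℝ) : Prop where
  measurable_succ : ∀ i, Measurable[𝓕 (i + 1)] (e i)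
  indep : ∀ i, Indep (𝓕 i) (MeasurableSpace.comap (e i) inferInstance) P
  memLp_two : ∀ i, MemLp (e i) 2 P
  integral_eq_zero : ∀ i, ∫ w, e i w ∂P = 0

/-- The absolute moments of order `q` of the random variables `e i` are at most `M`. -/
structure HasMomentBound (P : Measure Ω) (e : ℕ → Ω → ℝ) (q M : ℝ) : Prop where
  integrable : ∀ i, Integrable (fun w => |e i w| ^ q) P
  integral_le : ∀ i, ∫ w, |e i w| ^ q ∂P ≤ M

/-- The predictable quadratic variation `∑_{i < k} X_i² 𝔼[e_i²]` of `weightedSum X e`. -/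
noncomputable def predictableVariation (P : Measure Ω) (X e : ℕ → Ω → ℝ) (k : ℕ) (w : Ω) : ℝ :=
  ∑ i ∈ Finset.range k, X i w ^ 2 * ∫ w', e i w' ^ 2 ∂P

/-- The exponential `exp (i S_k)` of the weighted sum `S_k`, multiplied by `exp (T_k / 2)` with
`T_k` the predictable variation. It would be a martingale if the innovations were Gaussian. -/
noncomputable def compensatedExp (P : Measure Ω) (X e : ℕ → Ω → ℝ) (k : ℕ) (w : Ω) : ℂ :=
  Complex.exp (weightedSum X e k w * Complex.I) *
    (Real.exp (predictableVariation P X e k w / 2) : ℝ)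

namespace IsInnovation

theorem measurable (he : IsInnovation 𝓕 P e) (i : ℕ) : Measurable (e i) :=
  (he.measurable_succ i).mono (𝓕.le _) le_rfl

theorem indepFun (he : IsInnovation 𝓕 P e) {i : ℕ} {α : Type*} [MeasurableSpace α] {Y : Ω → α}
    (hY : Measurable[𝓕 i] Y) : IndepFun Y (e i) P :=
  (IndepFun_iff_Indep ..).2 (indep_of_indep_of_le_left (he.indep i) hY.comap_le)

theorem measurable_weightedSum (he : IsInnovation 𝓕 P e) (hX : ∀ i, Measurable[𝓕 i] (X i))
    (k : ℕ) : Measurable[𝓕 k] (weightedSum X e k) := by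
  refine Finset.measurable_fun_sum _ fun i hi => ?_
  have hik : i + 1 ≤ k := Finset.mem_range.1 hi
  exact ((hX i).mono (𝓕.mono (by omega)) le_rfl).mul
    ((he.measurable_succ i).mono (𝓕.mono hik) le_rfl)

theorem memLp_mul (he : IsInnovation 𝓕 P e) {i : ℕ} {Y : Ω → ℝ} (hY : Measurable[𝓕 i] Y)
    (hY2 : MemLp Y 2 P) : MemLp (fun w => Y w * e i w) 2 P := by
  have hYe : Measurable fun w => Y w * e i w := (hY.mono (𝓕.le i) le_rfl).mul (he.measurable i)
  refine (memLp_two_iff_integrable_sq hYe.aestronglyMeasurable).2 ?_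
  simp_rw [mul_pow]
  exact ((he.indepFun hY).comp (φ := (· ^ 2)) (ψ := (· ^ 2)) (by fun_prop)
    (by fun_prop)).integrable_mul hY2.integrable_sq (he.memLp_two i).integrable_sq

theorem integral_mul_eq_zero (he : IsInnovation 𝓕 P e) {i : ℕ} {Y : Ω → ℝ}
    (hY : Measurable[𝓕 i] Y) : ∫ w, Y w * e i w ∂P = 0 := by
  rw [(he.indepFun hY).integral_fun_mul_eq_mul_integral
    (hY.mono (𝓕.le i) le_rfl).aestronglyMeasurable (he.measurable i).aestronglyMeasurable,
    he.integral_eq_zero, mul_zero]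

theorem integral_mul_sq (he : IsInnovation 𝓕 P e) {i : ℕ} {Y : Ω → ℝ} (hY : Measurable[𝓕 i] Y) :
    ∫ w, (Y w * e i w) ^ 2 ∂P = (∫ w, Y w ^ 2 ∂P) * ∫ w, e i w ^ 2 ∂P := by
  have hY' : Measurable Y := hY.mono (𝓕.le i) le_rfl
  have he' := he.measurable i
  simp_rw [mul_pow]
  exact ((he.indepFun hY).comp (φ := (· ^ 2)) (ψ := (· ^ 2)) (by fun_prop)
    (by fun_prop)).integral_fun_mul_eq_mul_integral (by fun_prop) (by fun_prop)

theorem memLp_weightedSum (he : IsInnovation 𝓕 P e) (hX : ∀ i, Measurable[𝓕 i] (X i))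
    (hX2 : ∀ i, MemLp (X i) 2 P) (k : ℕ) : MemLp (weightedSum X e k) 2 P :=
  memLp_finsetSum _ fun i _ => he.memLp_mul (hX i) (hX2 i)

theorem integral_weightedSum_sq (he : IsInnovation 𝓕 P e) (hX : ∀ i, Measurable[𝓕 i] (X i))
    (hX2 : ∀ i, MemLp (X i) 2 P) (k : ℕ) :
    ∫ w, weightedSum X e k w ^ 2 ∂P
      = ∑ i ∈ Finset.range k, (∫ w, X i w ^ 2 ∂P) * ∫ w, e i w ^ 2 ∂P := by
  induction k with
  | zero => simp [weightedSum]
  | succ k ih =>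
    have hS := he.memLp_weightedSum hX hX2 k
    have hXe := he.memLp_mul (hX k) (hX2 k)
    have cross_eq : ∫ w, weightedSum X e k w * (X k w * e k w) ∂P = 0 := by
      simpa only [mul_assoc, Pi.mul_apply] using
        he.integral_mul_eq_zero ((he.measurable_weightedSum hX k).mul (hX k))
    have cross_int : Integrable (fun w => 2 * (weightedSum X e k w * (X k w * e k w))) P :=
      (hS.integrable_mul hXe).const_mul 2
    calc ∫ w, weightedSum X e (k + 1) w ^ 2 ∂P
        = ∫ w, (weightedSum X e k w ^ 2 + 2 * (weightedSum X e k w * (X k w * e k w))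
            + (X k w * e k w) ^ 2) ∂P := by
          congr 1 with w
          rw [weightedSum, Finset.sum_range_succ, ← weightedSum]
          ring
      _ = ∫ w, weightedSum X e k w ^ 2 ∂P + ∫ w, (X k w * e k w) ^ 2 ∂P := by
          rw [integral_add (f := fun w => weightedSum X e k w ^ 2 +
              2 * (weightedSum X e k w * (X k w * e k w)))
            (hS.integrable_sq.add cross_int) hXe.integrable_sq,
            integral_add hS.integrable_sq cross_int, integral_const_mul, cross_eq, mul_zero,
            add_zero]
      _ = _ := by rw [ih, he.integral_mul_sq (hX k), Finset.sum_range_succ]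

end IsInnovation

theorem measurable_predictableVariation_succ (hX : ∀ i, Measurable[𝓕 i] (X i)) (k : ℕ) :
    Measurable[𝓕 k] (predictableVariation P X e (k + 1)) :=
  Finset.measurable_fun_sum _ fun i hi =>
    (((hX i).mono (𝓕.mono (Nat.lt_succ_iff.1 (Finset.mem_range.1 hi)))
      le_rfl).pow_const 2).mul_const _

theorem measurable_predictableVariation (hX : ∀ i, Measurable (X i)) (k : ℕ) :
    Measurable (predictableVariation P X e k) :=
  Finset.measurable_fun_sum _ fun i _ => ((hX i).pow_const 2).mul_const _

theorem predictableVariation_nonneg (k : ℕ) (w : Ω) : 0 ≤ predictableVariation P X e k w :=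
  Finset.sum_nonneg fun _ _ => mul_nonneg (sq_nonneg _) (integral_nonneg fun _ => sq_nonneg _)

theorem predictableVariation_mul_left (s : ℝ) (k : ℕ) (w : Ω) :
    predictableVariation P (fun i w => s * X i w) e k w
      = s ^ 2 * predictableVariation P X e k w := by
  simp only [predictableVariation, Finset.mul_sum, mul_pow, mul_assoc]

theorem compensatedExp_succ_sub (k : ℕ) (w : Ω) :
    compensatedExp P X e (k + 1) w - compensatedExp P X e k w =
      Complex.exp (weightedSum X e k w * Complex.I) *
        (Real.exp (predictableVariation P X e (k + 1) w / 2) : ℝ) *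
      (Complex.exp ((X k w * e k w : ℝ) * Complex.I)
        - (Real.exp (-(X k w ^ 2 * (∫ w', e k w' ^ 2 ∂P) / 2)) : ℝ)) := by
  have variation_split : Real.exp (predictableVariation P X e k w / 2)
      = Real.exp (predictableVariation P X e (k + 1) w / 2) *
        Real.exp (-(X k w ^ 2 * (∫ w', e k w' ^ 2 ∂P) / 2)) := by
    rw [← Real.exp_add, predictableVariation, predictableVariation, Finset.sum_range_succ]
    ring_nf
  have sum_split : Complex.exp (weightedSum X e (k + 1) w * Complex.I)
      = Complex.exp (weightedSum X e k w * Complex.I) *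
        Complex.exp ((X k w * e k w : ℝ) * Complex.I) := by
    rw [← Complex.exp_add, ← add_mul, ← Complex.ofReal_add, weightedSum, weightedSum,
      Finset.sum_range_succ]
  rw [compensatedExp, compensatedExp, variation_split, sum_split]
  push_cast
  ring

theorem norm_exp_weightedSum_mul_exp (j k : ℕ) (w : Ω) :
    ‖Complex.exp (weightedSum X e j w * Complex.I) *
      (Real.exp (predictableVariation P X e k w / 2) : ℝ)‖
      = Real.exp (predictableVariation P X e k w / 2) := by
  rw [norm_mul, Complex.norm_exp_ofReal_mul_I, one_mul, Complex.norm_real, Real.norm_eq_abs,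
    Real.abs_exp]

theorem HasMomentBound.nonneg (hM : HasMomentBound P e q M) : 0 ≤ M :=
  (integral_nonneg fun w => by positivity).trans (hM.integral_le 0)

variable [IsProbabilityMeasure P]

namespace HasMomentBound

theorem integral_sq_le (hM : HasMomentBound P e q M) (hq : 2 ≤ q) {i : ℕ} (he : MemLp (e i) 2 P) :
    ∫ w, e i w ^ 2 ∂P ≤ 1 + M := by
  have sq_le : ∀ x : ℝ, x ^ 2 ≤ 1 + |x| ^ q := fun x => by
    rw [← sq_abs, ← Real.rpow_two]
    rcases le_total |x| 1 with hx | hx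
    · exact (Real.rpow_le_one (abs_nonneg x) hx zero_le_two).trans
        (le_add_of_nonneg_right (by positivity))
    · exact (Real.rpow_le_rpow_of_exponent_le hx hq).trans (le_add_of_nonneg_left zero_le_one)
  calc ∫ w, e i w ^ 2 ∂P ≤ ∫ w, (1 + |e i w| ^ q) ∂P :=
        integral_mono he.integrable_sq ((integrable_const _).add (hM.integrable i))
          fun w => sq_le (e i w)
    _ = 1 + ∫ w, |e i w| ^ q ∂P := by
        rw [integral_add (integrable_const _) (hM.integrable i), integral_const, probReal_univ,
          one_smul]
    _ ≤ 1 + M := by gcongr; exact hM.integral_le i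

theorem predictableVariation_le (hM : HasMomentBound P e q M) (hq : 2 ≤ q)
    (he : ∀ i, MemLp (e i) 2 P) (hK : ∀ i w, |X i w| ≤ K) (k : ℕ) (w : Ω) :
    predictableVariation P X e k w ≤ k * (K ^ 2 * (1 + M)) := by
  calc predictableVariation P X e k w
      ≤ ∑ i ∈ Finset.range k, K ^ 2 * (1 + M) := by
        refine Finset.sum_le_sum fun i _ => mul_le_mul ?_ (hM.integral_sq_le hq (he i))
          (integral_nonneg fun _ => sq_nonneg _) (sq_nonneg K)
        exact sq_le_sq.2 ((hK i w).trans (le_abs_self K))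
    _ = k * (K ^ 2 * (1 + M)) := by simp

theorem norm_exp_weightedSum_mul_exp_le (hM : HasMomentBound P e q M) (hq : 2 ≤ q)
    (he : ∀ i, MemLp (e i) 2 P) (hK : ∀ i w, |X i w| ≤ K) (j k : ℕ) (w : Ω) :
    ‖Complex.exp (weightedSum X e j w * Complex.I) *
      (Real.exp (predictableVariation P X e k w / 2) : ℝ)‖
      ≤ Real.exp (k * (K ^ 2 * (1 + M)) / 2) := by
  rw [norm_exp_weightedSum_mul_exp]
  gcongr
  exact hM.predictableVariation_le hq he hK k w

end HasMomentBound

namespace IsInnovation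

theorem integrable_compensatedExp (he : IsInnovation 𝓕 P e) (hM : HasMomentBound P e q M)
    (hq : 2 ≤ q) (hX : ∀ i, Measurable[𝓕 i] (X i)) (hK : ∀ i w, |X i w| ≤ K) (k : ℕ) :
    Integrable (compensatedExp P X e k) P := by
  have hS : Measurable (weightedSum X e k) :=
    (he.measurable_weightedSum hX k).mono (𝓕.le k) le_rfl
  have hT : Measurable (predictableVariation P X e k) :=
    measurable_predictableVariation (fun i => (hX i).mono (𝓕.le i) le_rfl) k
  unfold compensatedExp
  exact Integrable.of_bound (by fun_prop) _
    (ae_of_all _ (hM.norm_exp_weightedSum_mul_exp_le hq he.memLp_two hK k k))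

theorem norm_integral_compensatedExp_succ_sub_le (he : IsInnovation 𝓕 P e)
    (hM : HasMomentBound P e q M) (hq2 : 2 ≤ q) (hq3 : q ≤ 3) (hX : ∀ i, Measurable[𝓕 i] (X i))
    (hK : ∀ i w, |X i w| ≤ K) (k : ℕ) :
    ‖∫ w, (compensatedExp P X e (k + 1) w - compensatedExp P X e k w) ∂P‖
      ≤ Real.exp ((k + 1 : ℕ) * (K ^ 2 * (1 + M)) / 2) * (5 * (K ^ q * M)) := by
  have factor_measurable : Measurable[𝓕 k] fun w =>
      Complex.exp (weightedSum X e k w * Complex.I) *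
        (Real.exp (predictableVariation P X e (k + 1) w / 2) : ℝ) :=
    (Complex.measurable_exp.comp
      ((Complex.measurable_ofReal.comp (he.measurable_weightedSum hX k)).mul_const _)).mul
    (Complex.measurable_ofReal.comp
      (Real.measurable_exp.comp ((measurable_predictableVariation_succ hX k).div_const _)))
  simp_rw [compensatedExp_succ_sub]
  exact norm_integral_mul_exp_sub_gaussian_le (factor_measurable.mono (𝓕.le k) le_rfl)
    ((hX k).mono (𝓕.le k) le_rfl) (he.measurable k)
    (he.indepFun (factor_measurable.prodMk (hX k))) hq2 hq3 (he.memLp_two k)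
    (he.integral_eq_zero k) (hM.integrable k) (hM.integral_le k)
    (hM.norm_exp_weightedSum_mul_exp_le hq2 he.memLp_two hK k (k + 1)) (hK k)

theorem norm_integral_compensatedExp_sub_one_le (he : IsInnovation 𝓕 P e)
    (hM : HasMomentBound P e q M) (hq2 : 2 ≤ q) (hq3 : q ≤ 3) (hX : ∀ i, Measurable[𝓕 i] (X i))
    (hK : ∀ i w, |X i w| ≤ K) (k : ℕ) :
    ‖∫ w, compensatedExp P X e k w ∂P - 1‖
      ≤ k * (Real.exp (k * (K ^ 2 * (1 + M)) / 2) * (5 * (K ^ q * M))) := by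
  have M_nonneg := hM.nonneg
  obtain ⟨w₀⟩ := P.nonempty_of_neZero
  have K_nonneg : 0 ≤ K := (abs_nonneg _).trans (hK 0 w₀)
  induction k with
  | zero => simp [compensatedExp, weightedSum, predictableVariation]
  | succ k ih =>
    have G_int := he.integrable_compensatedExp hM hq2 hX hK
    have telescope : ∫ w, compensatedExp P X e (k + 1) w ∂P - 1
        = (∫ w, compensatedExp P X e k w ∂P - 1) +
          ∫ w, (compensatedExp P X e (k + 1) w - compensatedExp P X e k w) ∂P := by
      rw [integral_sub (G_int (k + 1)) (G_int k)]
      ring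
    rw [telescope, Nat.cast_succ, add_one_mul]
    refine (norm_add_le _ _).trans (add_le_add (ih.trans ?_) ?_)
    · gcongr
      linarith
    · exact_mod_cast he.norm_integral_compensatedExp_succ_sub_le hM hq2 hq3 hX hK k

end IsInnovation

end WeightedSums

section CentralLimitTheorem

theorem tendsto_of_forall_approx {E ι : Type*} [SeminormedAddCommGroup E] {l : Filter ι} [l.NeBot]
    {a : ℕ → E} {L : E} {b : ι → ℕ → E} {r : ι → ℕ → ℝ} {M : ι → E} {s : ι → ℝ}
    (hle : ∀ᶠ i in l, ∀ n, ‖a n - b i n‖ ≤ r i n)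
    (hr : ∀ᶠ i in l, Tendsto (r i) atTop (𝓝 (s i)))
    (hb : ∀ᶠ i in l, Tendsto (b i) atTop (𝓝 (M i)))
    (hs : Tendsto s l (𝓝 0)) (hM : Tendsto M l (𝓝 L)) : Tendsto a atTop (𝓝 L) := by
  rw [Metric.tendsto_nhds]
  intro δ hδ
  have hδ3 : 0 < δ / 3 := by positivity
  obtain ⟨i, hle, hr, hb, hs, hM⟩ := (hle.and (hr.and (hb.and
    ((hs.eventually_lt_const hδ3).and (Metric.tendsto_nhds.1 hM _ hδ3))))).exists
  filter_upwards [hr.eventually_lt_const hs, Metric.tendsto_nhds.1 hb _ hδ3] with n hrn hbn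
  have han := hle n
  rw [← dist_eq_norm] at han
  linarith [dist_triangle4 (a n) (b i n) (M i) L]

theorem natCast_mul_inv_sqrt_rpow {N : ℕ} (hN : N ≠ 0) (q : ℝ) :
    (N : ℝ) * (√(N : ℝ))⁻¹ ^ q = (N : ℝ) ^ (-(q / 2 - 1)) := by
  have hN' : (0 : ℝ) < N := by exact_mod_cast hN.bot_lt
  rw [Real.sqrt_eq_rpow, ← Real.rpow_neg hN'.le, ← Real.rpow_mul hN'.le]
  nth_rewrite 1 [← Real.rpow_one (N : ℝ)]
  rw [← Real.rpow_add hN']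
  ring_nf

theorem tendsto_natCast_mul_exp_mul_rpow {q : ℝ} (hq : 2 < q) (L C D : ℝ) (hL : 0 ≤ L) :
    Tendsto (fun N : ℕ => N * (Real.exp (N * (((√(N : ℝ))⁻¹ * L) ^ 2 * C) / 2) *
      (5 * (((√(N : ℝ))⁻¹ * L) ^ q * D)))) atTop (𝓝 0) := by
  have decay : Tendsto (fun N : ℕ => (N : ℝ) ^ (-(q / 2 - 1))) atTop (𝓝 0) :=
    (tendsto_rpow_neg_atTop (by linarith)).comp tendsto_natCast_atTop_atTop
  have := decay.const_mul (Real.exp (L ^ 2 * C / 2) * (5 * (L ^ q * D)))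
  rw [mul_zero] at this
  refine this.congr' ?_
  filter_upwards [eventually_ne_atTop 0] with N hN
  have hN' : (N : ℝ) ≠ 0 := by exact_mod_cast hN
  have exponent_eq : N * (((√(N : ℝ))⁻¹ * L) ^ 2 * C) / 2 = L ^ 2 * C / 2 := by
    rw [mul_pow, inv_pow, Real.sq_sqrt N.cast_nonneg]
    field_simp
  rw [exponent_eq, ← natCast_mul_inv_sqrt_rpow hN, Real.mul_rpow (by positivity) hL]
  ring

variable {Ω : Type*} [mΩ : MeasurableSpace Ω] {P : Measure Ω} [IsProbabilityMeasure P]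
  {𝓕 : Filtration ℕ mΩ} {X Y e : ℕ → Ω → ℝ} {q M K : ℝ}

namespace IsInnovation

theorem tendsto_integral_compensatedExp (he : IsInnovation 𝓕 P e) (hM : HasMomentBound P e q M)
    (hq2 : 2 < q) (hq3 : q ≤ 3) (hX : ∀ i, Measurable[𝓕 i] (X i)) (hK : ∀ i w, |X i w| ≤ K)
    (u : ℝ) :
    Tendsto (fun N : ℕ => ∫ w, compensatedExp P (fun i w => u * (√(N : ℝ))⁻¹ * X i w) e N w ∂P)
      atTop (𝓝 1) := by
  obtain ⟨w₀⟩ := P.nonempty_of_neZero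
  have K_nonneg : 0 ≤ K := (abs_nonneg _).trans (hK 0 w₀)
  rw [tendsto_iff_norm_sub_tendsto_zero]
  refine squeeze_zero (fun _ => norm_nonneg _) (fun N => ?_)
    (tendsto_natCast_mul_exp_mul_rpow hq2 (|u| * K) (1 + M) M (by positivity))
  refine he.norm_integral_compensatedExp_sub_one_le hM hq2.le hq3
    (fun i => (hX i).const_mul _) (fun i w => ?_) N
  rw [abs_mul, abs_mul, abs_of_nonneg (a := (√(N : ℝ))⁻¹) (by positivity), mul_comm |u|, mul_assoc]
  gcongr
  exact hK i w

theorem norm_integral_exp_mul_sub_integral_compensatedExp_le (he : IsInnovation 𝓕 P e)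
    (hM : HasMomentBound P e q M) (hq : 2 ≤ q) (hX : ∀ i, Measurable[𝓕 i] (X i))
    (hK : ∀ i w, |X i w| ≤ K) {k : ℕ} {R τ : ℝ} (hτ : τ / 2 ≤ R)
    (hT : ∀ w, predictableVariation P X e k w / 2 ≤ R) :
    ‖(∫ w, Complex.exp (weightedSum X e k w * Complex.I) ∂P) * (Real.exp (τ / 2) : ℝ)
        - ∫ w, compensatedExp P X e k w ∂P‖
      ≤ Real.exp R / 2 * ∫ w, |predictableVariation P X e k w - τ| ∂P := by
  have S_measurable : Measurable (weightedSum X e k) :=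
    (he.measurable_weightedSum hX k).mono (𝓕.le k) le_rfl
  have T_measurable : Measurable (predictableVariation P X e k) :=
    measurable_predictableVariation (fun i => (hX i).mono (𝓕.le i) le_rfl) k
  have T_int : Integrable (predictableVariation P X e k) P := by
    refine Integrable.of_bound T_measurable.aestronglyMeasurable (2 * R) (ae_of_all _ fun w => ?_)
    rw [Real.norm_eq_abs, abs_of_nonneg (predictableVariation_nonneg k w)]
    linarith [hT w]
  have diff_int : Integrable (fun w => |predictableVariation P X e k w - τ|) P :=
    (T_int.sub (integrable_const τ)).abs
  rw [← integral_mul_const, ← integral_sub ((integrable_exp_mul_I S_measurable).mul_const _)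
    (he.integrable_compensatedExp hM hq hX hK k), ← integral_const_mul]
  refine norm_integral_le_of_norm_le (diff_int.const_mul _) (ae_of_all _ fun w => ?_)
  rw [compensatedExp, ← mul_sub, norm_mul, Complex.norm_exp_ofReal_mul_I, one_mul,
    ← Complex.ofReal_sub, Complex.norm_real, Real.norm_eq_abs]
  refine (abs_exp_sub_exp_le hτ (hT w)).trans_eq ?_
  rw [abs_sub_comm, ← sub_div, abs_div, abs_two]
  ring

theorem tendsto_integral_exp_weightedSum_mul (he : IsInnovation 𝓕 P e)
    (hM : HasMomentBound P e q M) (hq : 2 ≤ q) (hX : ∀ i, Measurable[𝓕 i] (X i))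
    (hK : ∀ i w, |X i w| ≤ K) {σ2 : ℝ}
    (hlim : Tendsto (fun N : ℕ => ∫ w, |(N : ℝ)⁻¹ * predictableVariation P X e N w - σ2| ∂P)
      atTop (𝓝 0)) (u : ℝ) :
    Tendsto (fun N : ℕ =>
      (∫ w, Complex.exp ((u * ((√(N : ℝ))⁻¹ * weightedSum X e N w) : ℝ) * Complex.I) ∂P) *
          (Real.exp (u ^ 2 * σ2 / 2) : ℝ)
        - ∫ w, compensatedExp P (fun i w => u * (√(N : ℝ))⁻¹ * X i w) e N w ∂P) atTop (𝓝 0) := by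
  set R : ℝ := max (u ^ 2 * σ2 / 2) (u ^ 2 * (K ^ 2 * (1 + M)) / 2)
  have error_tendsto := (hlim.const_mul (u ^ 2)).const_mul (Real.exp R / 2)
  rw [mul_zero, mul_zero] at error_tendsto
  refine squeeze_zero_norm (fun N => ?_) error_tendsto
  have scaled_variation (w : Ω) :
      predictableVariation P (fun i w => u * (√(N : ℝ))⁻¹ * X i w) e N w
        = u ^ 2 * ((N : ℝ)⁻¹ * predictableVariation P X e N w) := by
    rw [predictableVariation_mul_left, mul_pow, inv_pow, Real.sq_sqrt N.cast_nonneg, mul_assoc]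
  have average_le (w : Ω) : (N : ℝ)⁻¹ * predictableVariation P X e N w ≤ K ^ 2 * (1 + M) := by
    have M_nonneg := hM.nonneg
    exact inv_mul_le_of_le_mul₀ N.cast_nonneg (by positivity)
      (hM.predictableVariation_le hq he.memLp_two hK N w)
  have bound := he.norm_integral_exp_mul_sub_integral_compensatedExp_le hM hq
    (X := fun i w => u * (√(N : ℝ))⁻¹ * X i w) (K := |u * (√(N : ℝ))⁻¹| * K)
    (fun i => (hX i).const_mul _) (fun i w => by rw [abs_mul]; gcongr; exact hK i w)
    (k := N) (R := R) (τ := u ^ 2 * σ2) (le_max_left _ _) fun w => by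
      rw [scaled_variation]
      exact (div_le_div_of_nonneg_right (mul_le_mul_of_nonneg_left (average_le w) (sq_nonneg u))
        zero_le_two).trans (le_max_right _ _)
  simp_rw [weightedSum_mul_left, scaled_variation, ← mul_sub, abs_mul, integral_const_mul,
    abs_of_nonneg (sq_nonneg u)] at bound
  simpa only [mul_assoc] using bound

theorem tendsto_integral_exp_weightedSum_of_bounded (he : IsInnovation 𝓕 P e)
    (hM : HasMomentBound P e q M) (hq2 : 2 < q) (hq3 : q ≤ 3) (hX : ∀ i, Measurable[𝓕 i] (X i))
    (hK : ∀ i w, |X i w| ≤ K) {σ2 : ℝ}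
    (hlim : Tendsto (fun N : ℕ => ∫ w, |(N : ℝ)⁻¹ * predictableVariation P X e N w - σ2| ∂P)
      atTop (𝓝 0)) (u : ℝ) :
    Tendsto (fun N : ℕ =>
      ∫ w, Complex.exp ((u * ((√(N : ℝ))⁻¹ * weightedSum X e N w) : ℝ) * Complex.I) ∂P) atTop
      (𝓝 ((Real.exp (-(u ^ 2 * σ2 / 2)) : ℝ) : ℂ)) := by
  have compensated_tendsto := (he.tendsto_integral_exp_weightedSum_mul hM hq2.le hX hK hlim u).add
    (he.tendsto_integral_compensatedExp hM hq2 hq3 hX hK u)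
  have := compensated_tendsto.mul_const ((Real.exp (-(u ^ 2 * σ2 / 2)) : ℝ) : ℂ)
  rw [zero_add, one_mul] at this
  refine this.congr fun N => ?_
  rw [sub_add_cancel, mul_assoc, ← Complex.ofReal_mul, ← Real.exp_add, add_neg_cancel,
    Real.exp_zero, Complex.ofReal_one, mul_one]

theorem integral_abs_weightedSum_sub_le (he : IsInnovation 𝓕 P e) (hM : HasMomentBound P e q M)
    (hq : 2 ≤ q) (hX : ∀ i, Measurable[𝓕 i] (X i)) (hX2 : ∀ i, MemLp (X i) 2 P)
    (hY : ∀ i, Measurable[𝓕 i] (Y i)) (hY2 : ∀ i, MemLp (Y i) 2 P) (k : ℕ) :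
    ∫ w, |weightedSum X e k w - weightedSum Y e k w| ∂P
      ≤ √((1 + M) * ∑ i ∈ Finset.range k, ∫ w, (X i w - Y i w) ^ 2 ∂P) := by
  have diff_eq (w : Ω) : weightedSum X e k w - weightedSum Y e k w
      = weightedSum (fun i w => X i w - Y i w) e k w := by
    simp only [weightedSum, sub_mul, Finset.sum_sub_distrib]
  have D_measurable (i : ℕ) : Measurable[𝓕 i] fun w => X i w - Y i w := (hX i).sub (hY i)
  have D_memLp (i : ℕ) : MemLp (fun w => X i w - Y i w) 2 P := (hX2 i).sub (hY2 i)
  simp_rw [diff_eq]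
  refine (integral_abs_le_sqrt_integral_sq (he.memLp_weightedSum D_measurable D_memLp k)).trans
    (Real.sqrt_le_sqrt ?_)
  rw [he.integral_weightedSum_sq D_measurable D_memLp, mul_comm (1 + M), Finset.sum_mul]
  exact Finset.sum_le_sum fun i _ => mul_le_mul_of_nonneg_left
    (hM.integral_sq_le hq (he.memLp_two i)) (integral_nonneg fun _ => sq_nonneg _)

theorem norm_integral_exp_weightedSum_sub_le (he : IsInnovation 𝓕 P e)
    (hM : HasMomentBound P e q M) (hq : 2 ≤ q) (hX : ∀ i, Measurable[𝓕 i] (X i))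
    (hX2 : ∀ i, MemLp (X i) 2 P) (hY : ∀ i, Measurable[𝓕 i] (Y i)) (hY2 : ∀ i, MemLp (Y i) 2 P)
    (u : ℝ) (N : ℕ) :
    ‖∫ w, Complex.exp ((u * ((√(N : ℝ))⁻¹ * weightedSum X e N w) : ℝ) * Complex.I) ∂P
        - ∫ w, Complex.exp ((u * ((√(N : ℝ))⁻¹ * weightedSum Y e N w) : ℝ) * Complex.I) ∂P‖
      ≤ |u| * √((1 + M) * ((N : ℝ)⁻¹ * ∑ i ∈ Finset.range N, ∫ w, (X i w - Y i w) ^ 2 ∂P)) := by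
  have SX := he.memLp_weightedSum hX hX2 N
  have SY := he.memLp_weightedSum hY hY2 N
  have measurable_scaled {Z : ℕ → Ω → ℝ} (hZ : ∀ i, Measurable[𝓕 i] (Z i)) :
      Measurable fun w => u * ((√(N : ℝ))⁻¹ * weightedSum Z e N w) :=
    (((he.measurable_weightedSum hZ N).mono (𝓕.le N) le_rfl).const_mul _).const_mul u
  rw [← integral_sub (integrable_exp_mul_I (measurable_scaled hX))
    (integrable_exp_mul_I (measurable_scaled hY))]
  calc _ ≤ ∫ w, |u| * (√(N : ℝ))⁻¹ * |weightedSum X e N w - weightedSum Y e N w| ∂P := by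
        refine norm_integral_le_of_norm_le
          (((SX.sub SY).integrable one_le_two).abs.const_mul _) (ae_of_all _ fun w => ?_)
        refine (norm_exp_mul_I_sub_exp_mul_I_le _ _).trans_eq ?_
        rw [← mul_sub, ← mul_sub, abs_mul, abs_mul, abs_of_nonneg (a := (√(N : ℝ))⁻¹)
          (by positivity), mul_assoc]
    _ ≤ |u| * (√(N : ℝ))⁻¹ * √((1 + M) * ∑ i ∈ Finset.range N, ∫ w, (X i w - Y i w) ^ 2 ∂P) := by
        rw [integral_const_mul]
        gcongr
        exact he.integral_abs_weightedSum_sub_le hM hq hX hX2 hY hY2 N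
    _ = _ := by
        rw [mul_assoc, mul_left_comm (1 + M), Real.sqrt_mul (by positivity : 0 ≤ (N : ℝ)⁻¹),
          Real.sqrt_inv]

theorem tendsto_integral_exp_weightedSum_of_approx (he : IsInnovation 𝓕 P e)
    (hM : HasMomentBound P e q M) (hq2 : 2 < q) (hq3 : q ≤ 3) (hX : ∀ i, Measurable[𝓕 i] (X i))
    (hX2 : ∀ i, MemLp (X i) 2 P) {ι : Type*} {l : Filter ι} [l.NeBot] {Y : ι → ℕ → Ω → ℝ}
    {K σ2 d : ι → ℝ} {D : ι → ℕ → ℝ} {V : ℝ} (hY : ∀ᶠ ε in l, ∀ i, Measurable[𝓕 i] (Y ε i))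
    (hYK : ∀ᶠ ε in l, ∀ i w, |Y ε i w| ≤ K ε)
    (hvar : ∀ᶠ ε in l, Tendsto (fun N : ℕ =>
      ∫ w, |(N : ℝ)⁻¹ * predictableVariation P (Y ε) e N w - σ2 ε| ∂P) atTop (𝓝 0))
    (hσ2 : Tendsto σ2 l (𝓝 V))
    (hdist : ∀ᶠ ε in l, ∀ i, ∫ w, (X i w - Y ε i w) ^ 2 ∂P ≤ D ε i)
    (hD : ∀ᶠ ε in l, Tendsto (D ε) atTop (𝓝 (d ε))) (hd : Tendsto d l (𝓝 0)) (u : ℝ) :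
    Tendsto (fun N : ℕ =>
      ∫ w, Complex.exp ((u * ((√(N : ℝ))⁻¹ * weightedSum X e N w) : ℝ) * Complex.I) ∂P) atTop
      (𝓝 ((Real.exp (-(u ^ 2 * V / 2)) : ℝ) : ℂ)) := by
  have error_tendsto : Tendsto (fun ε => |u| * √((1 + M) * d ε)) l (𝓝 0) := by
    simpa using ((hd.const_mul (1 + M)).sqrt).const_mul |u|
  have gaussian_tendsto : Tendsto (fun ε => ((Real.exp (-(u ^ 2 * σ2 ε / 2)) : ℝ) : ℂ)) l
      (𝓝 ((Real.exp (-(u ^ 2 * V / 2)) : ℝ) : ℂ)) :=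
    ((Complex.continuous_ofReal.comp Real.continuous_exp).tendsto _).comp
      (((hσ2.const_mul (u ^ 2)).div_const 2).neg)
  refine tendsto_of_forall_approx ?_ ?_ ?_ error_tendsto gaussian_tendsto
    (b := fun ε N => ∫ w, Complex.exp
      ((u * ((√(N : ℝ))⁻¹ * weightedSum (Y ε) e N w) : ℝ) * Complex.I) ∂P)
    (r := fun ε N => |u| * √((1 + M) * ((N : ℝ)⁻¹ * ∑ i ∈ Finset.range N, D ε i)))
  · filter_upwards [hY, hYK, hdist] with ε hY hYK hdist N
    have Y_memLp (i : ℕ) : MemLp (Y ε i) 2 P := MemLp.of_bound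
      ((hY i).mono (𝓕.le i) le_rfl).aestronglyMeasurable (K ε) (ae_of_all _ (hYK i))
    refine (he.norm_integral_exp_weightedSum_sub_le hM hq2.le hX hX2 hY Y_memLp u N).trans ?_
    have M_nonneg : 0 ≤ M := hM.nonneg
    gcongr
    exact hdist _
  · filter_upwards [hD] with ε hD
    exact ((hD.cesaro.const_mul (1 + M)).sqrt).const_mul |u|
  · filter_upwards [hY, hYK, hvar] with ε hY hYK hvar
    exact he.tendsto_integral_exp_weightedSum_of_bounded hM hq2 hq3 hY hYK hvar u

end IsInnovation

end CentralLimitTheorem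

section WeakLaw

variable {Ω : Type*} [mΩ : MeasurableSpace Ω] {P : Measure Ω} [IsProbabilityMeasure P]

theorem integral_abs_sub_le_sqrt_variance_add {W : Ω → ℝ} (hW : MemLp W 2 P) (μ : ℝ) :
    ∫ w, |W w - μ| ∂P ≤ √Var[W; P] + |∫ w, W w ∂P - μ| := by
  have centred : MemLp (fun w => W w - ∫ w', W w' ∂P) 2 P := hW.sub (memLp_const _)
  have centred_int : Integrable (fun w => |W w - ∫ w', W w' ∂P|) P :=
    (centred.integrable one_le_two).abs
  calc ∫ w, |W w - μ| ∂P
      ≤ ∫ w, (|W w - ∫ w', W w' ∂P| + |∫ w', W w' ∂P - μ|) ∂P :=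
        integral_mono ((hW.integrable one_le_two).sub (integrable_const _)).abs
          (centred_int.add (integrable_const _)) fun w => abs_sub_le _ _ _
    _ = ∫ w, |W w - ∫ w', W w' ∂P| ∂P + |∫ w', W w' ∂P - μ| := by
        rw [integral_add centred_int (integrable_const _), integral_const, probReal_univ, one_smul]
    _ ≤ √Var[W; P] + |∫ w, W w ∂P - μ| := by
        rw [variance_eq_integral hW.aemeasurable]
        gcongr
        exact integral_abs_le_sqrt_integral_sq centred

variable {Y : ℕ → Ω → ℝ} {ρ : ℕ → ℝ}

theorem variance_sum_range_le (hY : ∀ i, MemLp (Y i) 2 P)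
    (hρ : ∀ i m, |cov[Y i, Y (i + m); P]| ≤ ρ m) (N : ℕ) :
    Var[fun w => ∑ i ∈ Finset.range N, Y i w; P] ≤ 2 * N * ∑ m ∈ Finset.range N, ρ m := by
  have ρ_nonneg (m : ℕ) : 0 ≤ ρ m := (abs_nonneg _).trans (hρ 0 m)
  induction N with
  | zero => simp [variance_eq_integral measurable_const.aemeasurable]
  | succ N ih =>
    have expand : Var[fun w => ∑ i ∈ Finset.range (N + 1), Y i w; P]
        = Var[fun w => ∑ i ∈ Finset.range N, Y i w; P]
          + 2 * cov[fun w => ∑ i ∈ Finset.range N, Y i w, Y N; P] + Var[Y N; P] := by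
      rw [← variance_add (memLp_finsetSum _ fun i _ => hY i) (hY N)]
      congr 1
      ext w
      simp [Finset.sum_range_succ]
    have cov_le : cov[fun w => ∑ i ∈ Finset.range N, Y i w, Y N; P]
        ≤ ∑ i ∈ Finset.range N, ρ (N - i) := by
      rw [covariance_fun_sum_left' (fun i _ => hY i) (hY N)]
      refine Finset.sum_le_sum fun i hi => ?_
      simpa [Nat.add_sub_cancel' (Finset.mem_range.1 hi).le] using
        (le_abs_self _).trans (hρ i (N - i))
    have var_le : Var[Y N; P] ≤ ρ 0 := by
      rw [← covariance_self (hY N).aemeasurable]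
      exact (le_abs_self _).trans (hρ N 0)
    have reflect : ∑ i ∈ Finset.range N, ρ (N - i) + ρ 0 = ∑ m ∈ Finset.range (N + 1), ρ m := by
      rw [← Finset.sum_range_reflect ρ (N + 1), Finset.sum_range_succ]
      simp
    have mono : 2 * (N : ℝ) * ∑ m ∈ Finset.range N, ρ m
        ≤ 2 * N * ∑ m ∈ Finset.range (N + 1), ρ m := by
      gcongr
      exacts [fun m _ _ => ρ_nonneg m, N.le_succ]
    rw [expand]
    push_cast
    linarith [ρ_nonneg 0]

theorem variance_average_le (hY : ∀ i, MemLp (Y i) 2 P)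
    (hρ : ∀ i m, |cov[Y i, Y (i + m); P]| ≤ ρ m) (N : ℕ) :
    Var[fun w => (N : ℝ)⁻¹ * ∑ i ∈ Finset.range N, Y i w; P]
      ≤ 2 * ((N : ℝ)⁻¹ * ∑ m ∈ Finset.range N, ρ m) := by
  rw [variance_const_mul]
  refine (mul_le_mul_of_nonneg_left (variance_sum_range_le hY hρ N) (by positivity)).trans_eq ?_
  rcases N.eq_zero_or_pos with rfl | hN
  · simp
  · field_simp

theorem tendsto_integral_abs_average_sub (hY : ∀ i, MemLp (Y i) 2 P)
    (hρ : ∀ i m, |cov[Y i, Y (i + m); P]| ≤ ρ m) (hρ0 : Tendsto ρ atTop (𝓝 0)) {μ : ℝ}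
    (hμ : Tendsto (fun i => ∫ w, Y i w ∂P) atTop (𝓝 μ)) :
    Tendsto (fun N : ℕ => ∫ w, |(N : ℝ)⁻¹ * (∑ i ∈ Finset.range N, Y i w) - μ| ∂P)
      atTop (𝓝 0) := by
  have fluctuation_tendsto : Tendsto (fun N : ℕ =>
      √(2 * ((N : ℝ)⁻¹ * ∑ m ∈ Finset.range N, ρ m))) atTop (𝓝 0) := by
    simpa using (hρ0.cesaro.const_mul 2).sqrt
  have bias_tendsto : Tendsto (fun N : ℕ =>
      |(N : ℝ)⁻¹ * ∑ i ∈ Finset.range N, ∫ w, Y i w ∂P - μ|) atTop (𝓝 0) := by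
    simpa using (hμ.cesaro.sub_const μ).abs
  have error_tendsto := fluctuation_tendsto.add bias_tendsto
  rw [add_zero] at error_tendsto
  refine squeeze_zero (fun N => integral_nonneg fun w => abs_nonneg _) (fun N => ?_) error_tendsto
  refine (integral_abs_sub_le_sqrt_variance_add
    ((memLp_finsetSum _ fun i _ => hY i).const_mul _) μ).trans ?_
  rw [integral_const_mul, integral_finsetSum _ fun i _ => (hY i).integrable one_le_two]
  gcongr
  exact variance_average_le hY hρ N

theorem tendsto_integral_abs_average_predictableVariation_sub {X e : ℕ → Ω → ℝ} {v₀ σ2 : ℝ}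
    (hX : ∀ i, MemLp (fun w => X i w ^ 2) 2 P) (he : ∀ i, ∫ w, e i w ^ 2 ∂P ≤ v₀)
    (he_lim : Tendsto (fun i => ∫ w, e i w ^ 2 ∂P) atTop (𝓝 1))
    (hρ : ∀ i m, |cov[fun w => X i w ^ 2, fun w => X (i + m) w ^ 2; P]| ≤ ρ m)
    (hρ0 : Tendsto ρ atTop (𝓝 0)) (hσ2 : Tendsto (fun i => ∫ w, X i w ^ 2 ∂P) atTop (𝓝 σ2)) :
    Tendsto (fun N : ℕ => ∫ w, |(N : ℝ)⁻¹ * predictableVariation P X e N w - σ2| ∂P)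
      atTop (𝓝 0) := by
  have v_nonneg (i : ℕ) : 0 ≤ ∫ w, e i w ^ 2 ∂P := integral_nonneg fun w => sq_nonneg _
  have mean_tendsto : Tendsto (fun i => ∫ w, X i w ^ 2 * (∫ w', e i w' ^ 2 ∂P) ∂P) atTop
      (𝓝 σ2) := by
    simpa only [integral_mul_const, mul_one] using hσ2.mul he_lim
  have rate_tendsto : Tendsto (fun m => v₀ ^ 2 * ρ m) atTop (𝓝 0) := by
    simpa using hρ0.const_mul (v₀ ^ 2)
  refine tendsto_integral_abs_average_sub (fun i => (hX i).mul_const _) (fun i m => ?_)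
    rate_tendsto mean_tendsto
  rw [covariance_mul_const_left, covariance_mul_const_right, abs_mul, abs_mul, mul_comm,
    mul_comm |cov[_, _; P]|, ← mul_assoc, sq, abs_of_nonneg (v_nonneg _),
    abs_of_nonneg (v_nonneg _)]
  have v₀_nonneg : 0 ≤ v₀ := (v_nonneg 0).trans (he 0)
  exact mul_le_mul (mul_le_mul (he _) (he _) (v_nonneg _) v₀_nonneg) (hρ i m) (abs_nonneg _)
    (by positivity)

theorem abs_covariance_le_mul_integral_abs {U V : Ω → ℝ} {B : ℝ} (hU : Measurable U)
    (hUB : ∀ w, |U w| ≤ B) (hV : MemLp V 2 P) :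
    |cov[U, V; P]| ≤ 2 * B * ∫ w, |V w| ∂P := by
  have U_memLp : MemLp U 2 P := MemLp.of_bound hU.aestronglyMeasurable B (ae_of_all _ hUB)
  have V_int := (hV.integrable one_le_two).abs
  have product_le : |∫ w, (U * V) w ∂P| ≤ B * ∫ w, |V w| ∂P := by
    rw [← integral_const_mul, ← Real.norm_eq_abs]
    refine norm_integral_le_of_norm_le (V_int.const_mul _) (ae_of_all _ fun w => ?_)
    rw [Pi.mul_apply, norm_mul]
    exact mul_le_mul_of_nonneg_right (hUB w) (abs_nonneg _)
  have mean_le : |∫ w, U w ∂P| ≤ B := by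
    rw [← Real.norm_eq_abs]
    exact (norm_integral_le_of_norm_le_const (ae_of_all _ hUB)).trans_eq
      (by rw [probReal_univ, mul_one])
  rw [covariance_eq_sub U_memLp hV]
  calc _ ≤ |∫ w, (U * V) w ∂P| + |(∫ w, U w ∂P) * ∫ w, V w ∂P| := abs_sub _ _
    _ ≤ B * ∫ w, |V w| ∂P + B * ∫ w, |V w| ∂P := by
        rw [abs_mul]
        gcongr
        · exact (abs_nonneg _).trans mean_le
        · exact abs_integral_le_integral_abs
    _ = 2 * B * ∫ w, |V w| ∂P := by ring

theorem abs_covariance_le_of_indepFun {U V V' : Ω → ℝ} {B : ℝ} (hU : Measurable U)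
    (hUB : ∀ w, |U w| ≤ B) (hV : MemLp V 2 P) (hV' : MemLp V' 2 P) (hind : IndepFun U V' P) :
    |cov[U, V; P]| ≤ 2 * B * ∫ w, |V w - V' w| ∂P := by
  have U_memLp : MemLp U 2 P := MemLp.of_bound hU.aestronglyMeasurable B (ae_of_all _ hUB)
  have h := abs_covariance_le_mul_integral_abs hU hUB (hV.sub hV')
  rwa [covariance_sub_right U_memLp hV hV', hind.covariance_eq_zero U_memLp hV', sub_zero] at h

end WeakLaw

section LaplaceTransform

theorem one_sub_exp_neg_mul_le {r t : ℝ} (hr : 0 ≤ r) (ht : 0 ≤ t) :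
    1 - Real.exp (-r * t) ≤ (1 + t) * (1 - Real.exp (-r)) := by
  have exp_le_one : Real.exp (-r) ≤ 1 := Real.exp_le_one_iff.2 (neg_nonpos.2 hr)
  rw [Real.exp_mul]
  rcases le_total t 1 with h | h
  · have := Real.rpow_le_rpow_of_exponent_ge (Real.exp_pos (-r)) exp_le_one h
    rw [Real.rpow_one] at this
    nlinarith
  · have bernoulli := one_add_mul_self_le_rpow_one_add (s := Real.exp (-r) - 1)
      (by linarith [Real.exp_pos (-r)]) h
    rw [add_sub_cancel] at bernoulli
    nlinarith

theorem exp_neg_mul_mul_one_add_le {ε t : ℝ} (hε : 0 < ε) (ht : 0 ≤ t) :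
    Real.exp (-ε * t) * (1 + t) ≤ (1 + 2 / ε) * Real.exp (-(ε / 2) * t) := by
  have one_add_le : 1 + t ≤ (1 + 2 / ε) * Real.exp (ε / 2 * t) :=
    calc 1 + t ≤ (1 + 2 / ε) * (ε / 2 * t + 1) := by
          have : (1 + 2 / ε) * (ε / 2 * t + 1) = 1 + t + (ε / 2 * t + 2 / ε) := by field_simp; ring
          linarith [show 0 ≤ ε / 2 * t + 2 / ε by positivity]
      _ ≤ _ := by gcongr; exact Real.add_one_le_exp _
  calc Real.exp (-ε * t) * (1 + t)
      ≤ Real.exp (-ε * t) * ((1 + 2 / ε) * Real.exp (ε / 2 * t)) := by gcongr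
    _ = (1 + 2 / ε) * Real.exp (-(ε / 2) * t) := by
        rw [mul_left_comm, ← Real.exp_add]
        ring_nf

theorem rpow_one_add_add_le {M s t : ℝ} (hM : 0 ≤ M) (hs : 0 ≤ s) (ht : 0 ≤ t) :
    (1 + (s + t)) ^ (-(2 * M)) ≤ (1 + s) ^ (-M) * (1 + t) ^ (-M) := by
  rw [← mul_neg, Real.rpow_mul (by positivity), ← Real.mul_rpow (by positivity) (by positivity)]
  refine Real.rpow_le_rpow_of_nonpos (by positivity) ?_ (neg_nonpos.2 hM)
  rw [Real.rpow_two]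
  nlinarith

theorem rpow_one_add_neg_mem_Icc {M t : ℝ} (hM : 0 ≤ M) (ht : 0 ≤ t) :
    (1 + t) ^ (-M) ∈ Set.Icc (0 : ℝ) 1 :=
  ⟨by positivity, Real.rpow_le_one_of_one_le_of_nonpos (by linarith) (neg_nonpos.2 hM)⟩

theorem aestronglyMeasurable_of_exp_neg_mul {μ : Measure ℝ} {g : ℝ → ℝ} {x : ℝ}
    (hg : AEStronglyMeasurable (fun t => Real.exp (-x * t) * g t) μ) :
    AEStronglyMeasurable g μ := by
  have exp_cont : Continuous fun t => Real.exp (x * t) := by fun_prop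
  refine (exp_cont.aestronglyMeasurable.mul hg).congr (ae_of_all _ fun t => ?_)
  simp only [Pi.mul_apply]
  rw [← mul_assoc, ← Real.exp_add]
  simp

variable {F f : ℝ → ℝ}

theorem selfConv_eq_setIntegral (f : ℝ → ℝ) {t : ℝ} (ht : 0 ≤ t) :
    selfConv f t = ∫ s in Set.Ioo 0 t, f s * f (t - s) := by
  rw [selfConv, intervalIntegral.integral_of_le ht, integral_Ioc_eq_integral_Ioo]

theorem selfConv_nonneg (hf : ∀ t : ℝ, 0 < t → 0 ≤ f t) {t : ℝ} (ht : 0 ≤ t) :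
    0 ≤ selfConv f t := by
  rw [selfConv_eq_setIntegral f ht]
  exact setIntegral_nonneg measurableSet_Ioo fun s hs =>
    mul_nonneg (hf s hs.1) (hf _ (sub_pos.2 hs.2))

theorem exp_mul_selfConv (f : ℝ → ℝ) (x t : ℝ) :
    Real.exp (-x * t) * selfConv f t = selfConv (fun s => Real.exp (-x * s) * f s) t := by
  rw [selfConv, selfConv, ← intervalIntegral.integral_const_mul]
  refine intervalIntegral.integral_congr fun s _ => ?_
  have split : Real.exp (-x * t) = Real.exp (-x * s) * Real.exp (-x * (t - s)) := by
    rw [← Real.exp_add]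
    ring_nf
  simp only [split]
  ring

theorem posConvolution_self_eq_selfConv (f : ℝ → ℝ) {t : ℝ} (ht : 0 < t) :
    posConvolution f f (ContinuousLinearMap.mul ℝ ℝ) volume t = selfConv f t := by
  simp only [posConvolution, Set.indicator_of_mem (Set.mem_Ioi.2 ht),
    ContinuousLinearMap.mul_apply', selfConv]

theorem integrableOn_selfConv (hf : IntegrableOn f (Set.Ioi 0)) :
    IntegrableOn (selfConv f) (Set.Ioi 0) :=
  (integrable_posConvolution hf hf (ContinuousLinearMap.mul ℝ ℝ)).integrableOn.congr_fun
    (fun _ ht => posConvolution_self_eq_selfConv f ht) measurableSet_Ioi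

theorem integral_selfConv (hf : IntegrableOn f (Set.Ioi 0)) :
    ∫ t in Set.Ioi 0, selfConv f t = (∫ t in Set.Ioi 0, f t) ^ 2 := by
  have := integral_posConvolution hf hf (ContinuousLinearMap.mul ℝ ℝ)
  simp only [ContinuousLinearMap.mul_apply'] at this
  rw [sq, ← this]
  rfl

theorem rpow_mul_selfConv_le {M : ℝ} (hM : 0 ≤ M) (hf : ∀ t : ℝ, 0 < t → 0 ≤ f t) {t : ℝ}
    (ht : 0 ≤ t) :
    (1 + t) ^ (-(2 * M)) * selfConv f t ≤ selfConv (fun s => (1 + s) ^ (-M) * f s) t := by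
  have weighted_nonneg (s : ℝ) (hs : 0 < s) : 0 ≤ (1 + s) ^ (-M) * f s :=
    mul_nonneg (by positivity) (hf s hs)
  by_cases hint : IntegrableOn (fun s => f s * f (t - s)) (Set.Ioo 0 t)
  · have weighted_eq (s : ℝ) : (1 + s) ^ (-M) * f s * ((1 + (t - s)) ^ (-M) * f (t - s))
        = (1 + s) ^ (-M) * (1 + (t - s)) ^ (-M) * (f s * f (t - s)) := by ring
    rw [selfConv_eq_setIntegral f ht, selfConv_eq_setIntegral _ ht, ← integral_const_mul]
    simp_rw [weighted_eq]
    have weighted_int : IntegrableOn (fun s => (1 + s) ^ (-M) * (1 + (t - s)) ^ (-M)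
        * (f s * f (t - s))) (Set.Ioo 0 t) := by
      refine Integrable.bdd_mul (c := 1) hint (Measurable.aestronglyMeasurable (by fun_prop)) ?_
      filter_upwards [ae_restrict_mem measurableSet_Ioo] with s hs
      have left_mem := rpow_one_add_neg_mem_Icc hM hs.1.le
      have right_mem := rpow_one_add_neg_mem_Icc hM (sub_nonneg.2 hs.2.le)
      rw [Real.norm_of_nonneg (mul_nonneg left_mem.1 right_mem.1)]
      exact mul_le_one₀ left_mem.2 right_mem.1 right_mem.2
    refine setIntegral_mono_on (hint.const_mul _) weighted_int measurableSet_Ioo fun s hs => ?_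
    refine mul_le_mul_of_nonneg_right ?_ (mul_nonneg (hf s hs.1) (hf _ (sub_pos.2 hs.2)))
    simpa using rpow_one_add_add_le hM hs.1.le (sub_nonneg.2 hs.2.le)
  · rw [selfConv_eq_setIntegral f ht, integral_undef hint, mul_zero]
    exact selfConv_nonneg weighted_nonneg ht

theorem integrableOn_rpow_mul_Ioi_one {c m : ℝ} (hf : ∀ t : ℝ, 1 ≤ t → 0 ≤ f t)
    (hgrowth : ∀ t : ℝ, 1 ≤ t → f t ≤ c * (1 + t) ^ m)
    (hmeas : AEStronglyMeasurable f (volume.restrict (Set.Ioi 1))) :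
    IntegrableOn (fun t => (1 + t) ^ (-(m + 2)) * f t) (Set.Ioi 1) := by
  have dominating_int : IntegrableOn (fun t : ℝ => c * (t + 1) ^ (-2 : ℝ)) (Set.Ioi 1) :=
    (integrableOn_add_rpow_Ioi_of_lt (by norm_num) (by norm_num)).const_mul _
  refine dominating_int.mono' ((Measurable.aestronglyMeasurable (by fun_prop)).mul hmeas) ?_
  filter_upwards [ae_restrict_mem measurableSet_Ioi] with t (ht : 1 < t)
  have one_add_pos : 0 < 1 + t := by linarith
  rw [Real.norm_of_nonneg (mul_nonneg (by positivity) (hf t ht.le))]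
  calc (1 + t) ^ (-(m + 2)) * f t ≤ (1 + t) ^ (-(m + 2)) * (c * (1 + t) ^ m) := by
        gcongr
        exact hgrowth t ht.le
    _ = c * (t + 1) ^ (-2 : ℝ) := by
        rw [mul_left_comm, ← Real.rpow_add one_add_pos, add_comm t]
        ring_nf

namespace IsPolyLaplace

theorem integrableOn_exp_mul_selfConv (hF : IsPolyLaplace F f) {x : ℝ} (hx : 0 < x) :
    IntegrableOn (fun t => Real.exp (-x * t) * selfConv f t) (Set.Ioi 0) := by
  simp_rw [exp_mul_selfConv]
  exact integrableOn_selfConv (hF.integrable x hx)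

theorem integral_exp_mul_selfConv (hF : IsPolyLaplace F f) {x : ℝ} (hx : 0 < x) :
    ∫ t in Set.Ioi 0, Real.exp (-x * t) * selfConv f t = laplaceTransform f x ^ 2 := by
  simp_rw [exp_mul_selfConv]
  exact integral_selfConv (hF.integrable x hx)

theorem aestronglyMeasurable (hF : IsPolyLaplace F f) :
    AEStronglyMeasurable f (volume.restrict (Set.Ioi 0)) :=
  aestronglyMeasurable_of_exp_neg_mul (hF.integrable 1 one_pos).aestronglyMeasurable

theorem aestronglyMeasurable_selfConv (hF : IsPolyLaplace F f) :
    AEStronglyMeasurable (selfConv f) (volume.restrict (Set.Ioi 0)) :=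
  aestronglyMeasurable_of_exp_neg_mul
    (hF.integrableOn_exp_mul_selfConv one_pos).aestronglyMeasurable

theorem measurable_laplaceTransform (hF : IsPolyLaplace F f) : Measurable (laplaceTransform f) := by
  obtain ⟨g, hg, hfg⟩ := hF.aestronglyMeasurable
  have laplace_eq : laplaceTransform f = laplaceTransform g := by
    ext s
    refine integral_congr_ae ?_
    filter_upwards [hfg] with t ht
    rw [ht]
  have integrand_meas : Measurable (Function.uncurry fun s t : ℝ => Real.exp (-s * t) * g t) := by
    have := hg.measurable
    fun_prop
  rw [laplace_eq]
  exact integrand_meas.stronglyMeasurable.integral_prod_right.measurable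

theorem laplaceTransform_nonneg (hF : IsPolyLaplace F f) (x : ℝ) : 0 ≤ laplaceTransform f x :=
  setIntegral_nonneg measurableSet_Ioi fun t ht =>
    mul_nonneg (Real.exp_pos _).le (hF.nonneg_right t ht)

theorem antitoneOn_laplaceTransform (hF : IsPolyLaplace F f) :
    AntitoneOn (laplaceTransform f) (Set.Ioi 0) := by
  intro x hx y hy hxy
  refine setIntegral_mono_on (hF.integrable y hy) (hF.integrable x hx)
    measurableSet_Ioi fun t (ht : 0 < t) => ?_
  have := hF.nonneg_right t ht
  gcongr

theorem exists_laplaceTransform_sub_le (hF : IsPolyLaplace F f) {ε : ℝ} (hε : 0 < ε) :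
    ∃ C, 0 ≤ C ∧ ∀ x r : ℝ, 0 ≤ x → 0 ≤ r →
      laplaceTransform f (ε + x) - laplaceTransform f (ε + (x + r)) ≤ C * (1 - Real.exp (-r)) := by
  refine ⟨(1 + 2 / ε) * laplaceTransform f (ε / 2),
    mul_nonneg (by positivity) (hF.laplaceTransform_nonneg _), fun x r hx hr => ?_⟩
  have int_x := hF.integrable (ε + x) (by positivity)
  have int_xr := hF.integrable (ε + (x + r)) (by positivity)
  rw [laplaceTransform, laplaceTransform, laplaceTransform, ← integral_sub int_x int_xr,
    mul_right_comm, ← integral_const_mul]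
  refine setIntegral_mono_on (int_x.sub int_xr)
    ((hF.integrable (ε / 2) (half_pos hε)).const_mul _) measurableSet_Ioi fun t (ht : 0 < t) => ?_
  have split : Real.exp (-(ε + (x + r)) * t) = Real.exp (-(ε + x) * t) * Real.exp (-r * t) := by
    rw [← Real.exp_add]
    ring_nf
  have exp_le : Real.exp (-(ε + x) * t) ≤ Real.exp (-ε * t) := Real.exp_le_exp.2 (by nlinarith)
  have gap_nonneg : 0 ≤ 1 - Real.exp (-r) := sub_nonneg.2 (Real.exp_le_one_iff.2 (by linarith))
  have f_nonneg := hF.nonneg_right t ht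
  calc Real.exp (-(ε + x) * t) * f t - Real.exp (-(ε + (x + r)) * t) * f t
      = Real.exp (-(ε + x) * t) * (1 - Real.exp (-r * t)) * f t := by rw [split]; ring
    _ ≤ Real.exp (-(ε + x) * t) * ((1 + t) * (1 - Real.exp (-r))) * f t := by
        gcongr
        exact one_sub_exp_neg_mul_le hr ht.le
    _ ≤ Real.exp (-ε * t) * ((1 + t) * (1 - Real.exp (-r))) * f t := by gcongr
    _ = Real.exp (-ε * t) * (1 + t) * (1 - Real.exp (-r)) * f t := by ring
    _ ≤ (1 + 2 / ε) * Real.exp (-(ε / 2) * t) * (1 - Real.exp (-r)) * f t := by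
        gcongr ?_ * (1 - _) * f t
        exact exp_neg_mul_mul_one_add_le hε ht.le
    _ = _ := by ring

theorem exists_integrableOn_rpow_mul (hF : IsPolyLaplace F f) :
    ∃ M : ℝ, 0 ≤ M ∧ IntegrableOn (fun t => (1 + t) ^ (-M) * f t) (Set.Ioi 0) := by
  obtain ⟨c, -, m, hm, hgrowth⟩ := hF.growth
  refine ⟨m + 2, by positivity, ?_⟩
  rw [← Set.Ioc_union_Ioi_eq_Ioi zero_le_one]
  refine IntegrableOn.union ?_ (integrableOn_rpow_mul_Ioi_one
    (fun t ht => hF.nonneg_right t (by linarith)) hgrowth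
    (hF.aestronglyMeasurable.mono_set (Set.Ioi_subset_Ioi zero_le_one)))
  have f_int : IntegrableOn f (Set.Ioc 0 1) := by
    have h := (hF.integrable 1 one_pos).mono_set
      (Set.Ioc_subset_Ioi_self : Set.Ioc (0 : ℝ) 1 ⊆ Set.Ioi 0)
    refine (h.const_mul (Real.exp 1)).mono'
      (hF.aestronglyMeasurable.mono_set Set.Ioc_subset_Ioi_self) ?_
    filter_upwards [ae_restrict_mem measurableSet_Ioc] with t ht
    have f_nonneg := hF.nonneg_right t ht.1
    rw [Real.norm_of_nonneg f_nonneg, ← mul_assoc, ← Real.exp_add]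
    exact le_mul_of_one_le_left f_nonneg (Real.one_le_exp (by linarith [ht.2]))
  refine f_int.bdd_mul (c := 1) (Measurable.aestronglyMeasurable (by fun_prop)) ?_
  filter_upwards [ae_restrict_mem measurableSet_Ioc] with t ht
  have weight_mem := rpow_one_add_neg_mem_Icc (M := m + 2) (by positivity) ht.1.le
  exact (Real.norm_of_nonneg weight_mem.1).trans_le weight_mem.2

theorem exists_integrableOn_rpow_mul_selfConv (hF : IsPolyLaplace F f) :
    ∃ M : ℝ, 0 ≤ M ∧ IntegrableOn (fun t => (1 + t) ^ (-M) * selfConv f t) (Set.Ioi 0) := by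
  obtain ⟨M, hM0, hM⟩ := hF.exists_integrableOn_rpow_mul
  refine ⟨2 * M, by positivity, (integrableOn_selfConv hM).mono'
    ((Measurable.aestronglyMeasurable (by fun_prop)).mul hF.aestronglyMeasurable_selfConv) ?_⟩
  filter_upwards [ae_restrict_mem measurableSet_Ioi] with t (ht : 0 < t)
  rw [Real.norm_of_nonneg (mul_nonneg (by positivity) (selfConv_nonneg hF.nonneg_right ht.le))]
  exact rpow_mul_selfConv_le hM0 hF.nonneg_right ht.le

end IsPolyLaplace

end LaplaceTransform

section RvLaplace

variable {Ω : Type*} [mΩ : MeasurableSpace Ω] {P : Measure Ω} {X : Ω → ℝ}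

theorem rvLaplace_eq_mgf (t : ℝ) : rvLaplace P X t = mgf X P (-t) := rfl

theorem rvLaplace_nonneg (t : ℝ) : 0 ≤ rvLaplace P X t := mgf_nonneg

theorem rvLaplace_congr_identDistrib {Y : Ω → ℝ} (h : IdentDistrib X Y P P) :
    rvLaplace P X = rvLaplace P Y := by
  ext t
  rw [rvLaplace_eq_mgf, rvLaplace_eq_mgf, mgf_congr_identDistrib h]

theorem rvLaplace_const_mul (s t : ℝ) :
    rvLaplace P (fun w => s * X w) t = rvLaplace P X (s * t) := by
  rw [rvLaplace_eq_mgf, rvLaplace_eq_mgf, mgf_const_mul, mul_neg]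

theorem rvLaplace_const_add (a t : ℝ) :
    rvLaplace P (fun w => a + X w) t = Real.exp (-a * t) * rvLaplace P X t := by
  rw [rvLaplace_eq_mgf, rvLaplace_eq_mgf, mgf_const_add]
  ring_nf

theorem measurable_rvLaplace [SFinite P] (hX : Measurable X) : Measurable (rvLaplace P X) :=
  have integrand_meas : Measurable (Function.uncurry fun (t : ℝ) w => Real.exp (-t * X w)) := by
    fun_prop
  integrand_meas.stronglyMeasurable.integral_prod_right.measurable

theorem exp_neg_mul_le_one_ae (hX0 : ∀ᵐ w ∂P, 0 ≤ X w) {t : ℝ} (ht : 0 ≤ t) :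
    ∀ᵐ w ∂P, Real.exp (-t * X w) ≤ 1 := by
  filter_upwards [hX0] with w hw
  exact Real.exp_le_one_iff.2 (mul_nonpos_of_nonpos_of_nonneg (neg_nonpos.2 ht) hw)

theorem integrable_exp_neg_mul [IsFiniteMeasure P] (hX : Measurable X) (hX0 : ∀ᵐ w ∂P, 0 ≤ X w)
    {t : ℝ} (ht : 0 ≤ t) : Integrable (fun w => Real.exp (-t * X w)) P := by
  refine Integrable.of_bound (by fun_prop) 1 ?_
  filter_upwards [exp_neg_mul_le_one_ae hX0 ht] with w hw
  rwa [Real.norm_of_nonneg (Real.exp_pos _).le]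

theorem ae_pos_of_tendsto_rvLaplace_zero [IsFiniteMeasure P] (hX : Measurable X)
    (hX0 : ∀ᵐ w ∂P, 0 ≤ X w) (hlim : Tendsto (rvLaplace P X) atTop (𝓝 0)) :
    ∀ᵐ w ∂P, 0 < X w := by
  have chernoff (t : ℝ) (ht : 0 ≤ t) : P.real {w | X w ≤ 0} ≤ rvLaplace P X t := by
    simpa [rvLaplace_eq_mgf] using
      measure_le_le_exp_mul_mgf 0 (neg_nonpos.2 ht) (integrable_exp_neg_mul hX hX0 ht)
  have nonpos : P.real {w | X w ≤ 0} ≤ 0 :=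
    ge_of_tendsto hlim ((eventually_ge_atTop 0).mono chernoff)
  simpa only [ae_iff, not_lt] using
    (measureReal_eq_zero_iff (measure_ne_top _ _)).1 (nonpos.antisymm measureReal_nonneg)

variable [IsProbabilityMeasure P]

theorem rvLaplace_zero : rvLaplace P X 0 = 1 := by
  rw [rvLaplace_eq_mgf, neg_zero, mgf_zero]

theorem one_sub_rvLaplace_eq_integral (hX : Measurable X) (hX0 : ∀ᵐ w ∂P, 0 ≤ X w) {t : ℝ}
    (ht : 0 ≤ t) : 1 - rvLaplace P X t = ∫ w, (1 - Real.exp (-t * X w)) ∂P := by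
  rw [integral_sub (integrable_const 1) (integrable_exp_neg_mul hX hX0 ht), integral_const,
    probReal_univ, one_smul, rvLaplace]

theorem rvLaplace_le_one (hX : Measurable X) (hX0 : ∀ᵐ w ∂P, 0 ≤ X w) {t : ℝ} (ht : 0 ≤ t) :
    rvLaplace P X t ≤ 1 := by
  rw [← sub_nonneg, one_sub_rvLaplace_eq_integral hX hX0 ht]
  exact integral_nonneg_of_ae ((exp_neg_mul_le_one_ae hX0 ht).mono fun w => sub_nonneg.2)

theorem one_sub_rvLaplace_mul_le (hX : Measurable X) (hX0 : ∀ᵐ w ∂P, 0 ≤ X w) {s t : ℝ}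
    (hs : 0 ≤ s) (ht : 0 ≤ t) :
    1 - rvLaplace P X (s * t) ≤ (1 + t) * (1 - rvLaplace P X s) := by
  have integrable_one_sub {r : ℝ} (hr : 0 ≤ r) :
      Integrable (fun w => 1 - Real.exp (-r * X w)) P :=
    (integrable_const 1).sub (integrable_exp_neg_mul hX hX0 hr)
  rw [one_sub_rvLaplace_eq_integral hX hX0 (mul_nonneg hs ht),
    one_sub_rvLaplace_eq_integral hX hX0 hs, ← integral_const_mul]
  refine integral_mono_ae (integrable_one_sub (mul_nonneg hs ht))
    ((integrable_one_sub hs).const_mul _) ?_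
  filter_upwards [hX0] with w hw
  rw [neg_mul, mul_right_comm, neg_mul s, ← neg_mul]
  exact one_sub_exp_neg_mul_le (mul_nonneg hs hw) ht

variable {F f : ℝ → ℝ}

theorem IsPolyLaplace.integrable_prod_exp_mul_selfConv (hF : IsPolyLaplace F f)
    (hX : Measurable X) (hX0 : ∀ᵐ w ∂P, 0 ≤ X w)
    (hint : IntegrableOn (fun t => selfConv f t * rvLaplace P X t) (Set.Ioi 0)) :
    Integrable (fun z : Ω × ℝ => Real.exp (-X z.1 * z.2) * selfConv f z.2)
      (P.prod (volume.restrict (Set.Ioi 0))) := by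
  have joint_meas : AEStronglyMeasurable
      (fun z : Ω × ℝ => Real.exp (-X z.1 * z.2) * selfConv f z.2)
      (P.prod (volume.restrict (Set.Ioi 0))) :=
    AEStronglyMeasurable.mul (by fun_prop) hF.aestronglyMeasurable_selfConv.comp_snd
  refine (integrable_prod_iff' joint_meas).2 ⟨?_, ?_⟩
  · filter_upwards [ae_restrict_mem measurableSet_Ioi] with t (ht : 0 < t)
    simpa only [neg_mul_comm, mul_comm (X _)] using
      (integrable_exp_neg_mul hX hX0 ht.le).mul_const (selfConv f t)
  · refine hint.congr_fun (fun t (ht : 0 < t) => ?_) measurableSet_Ioi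
    simp only [norm_mul, Real.norm_of_nonneg (selfConv_nonneg hF.nonneg_right ht.le),
      Real.norm_of_nonneg (Real.exp_pos _).le]
    rw [integral_mul_const, mul_comm, rvLaplace]
    simp only [neg_mul_comm, mul_comm (X _)]

theorem IsPolyLaplace.memLp_and_integral_sq_comp (hF : IsPolyLaplace F f) (hX : Measurable X)
    (hpos : ∀ᵐ w ∂P, 0 < X w)
    (hint : IntegrableOn (fun t => selfConv f t * rvLaplace P X t) (Set.Ioi 0)) :
    MemLp (fun w => laplaceTransform f (X w)) 2 P ∧
      ∫ w, laplaceTransform f (X w) ^ 2 ∂P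
        = ∫ t in Set.Ioi 0, selfConv f t * rvLaplace P X t := by
  have joint_int := hF.integrable_prod_exp_mul_selfConv hX (hpos.mono fun _ => le_of_lt) hint
  have sq_eq : (fun w => ∫ t in Set.Ioi 0, Real.exp (-X w * t) * selfConv f t)
      =ᵐ[P] fun w => laplaceTransform f (X w) ^ 2 := by
    filter_upwards [hpos] with w hw using hF.integral_exp_mul_selfConv hw
  refine ⟨(memLp_two_iff_integrable_sq
    (hF.measurable_laplaceTransform.comp hX).aestronglyMeasurable).2
      (joint_int.integral_prod_left.congr sq_eq), ?_⟩
  rw [← integral_congr_ae sq_eq, integral_integral_swap joint_int]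
  refine integral_congr_ae (ae_of_all _ fun t => ?_)
  simp only [integral_mul_const, rvLaplace, mul_comm (selfConv f t), neg_mul_comm, mul_comm (X _)]

end RvLaplace

/-- Nonnegative weights of total mass `1`. -/
structure IsProbabilityWeight (lam : ℕ → ℝ) : Prop where
  nonneg : ∀ n, 0 ≤ lam n
  hasSum : HasSum lam 1

/-- The mass `∑_{j ≥ n} λ_j` of a probability weight beyond lag `n`, written through the
complementary finite sum; it is the coefficient of `ω₀` in the moving average at time `n`. -/
noncomputable def tailWeight (lam : ℕ → ℝ) (n : ℕ) : ℝ := 1 - ∑ j ∈ Finset.range n, lam j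

namespace IsProbabilityWeight

variable {lam : ℕ → ℝ}

theorem tailWeight_nonneg (hlam : IsProbabilityWeight lam) (n : ℕ) : 0 ≤ tailWeight lam n :=
  sub_nonneg.2 (sum_le_hasSum _ (fun i _ => hlam.nonneg i) hlam.hasSum)

theorem antitone_tailWeight (hlam : IsProbabilityWeight lam) : Antitone (tailWeight lam) :=
  fun _ _ h => sub_le_sub_left (Finset.sum_le_sum_of_subset_of_nonneg (Finset.range_mono h)
    fun i _ _ => hlam.nonneg i) _

theorem tendsto_tailWeight (hlam : IsProbabilityWeight lam) :
    Tendsto (tailWeight lam) atTop (𝓝 0) := by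
  have tendsto_sub := hlam.hasSum.tendsto_sum_nat.const_sub 1
  rwa [sub_self] at tendsto_sub

theorem le_one (hlam : IsProbabilityWeight lam) (n : ℕ) : lam n ≤ 1 :=
  le_hasSum hlam.hasSum n fun i _ => hlam.nonneg i

theorem tailWeight_eq_zero_iff (hlam : IsProbabilityWeight lam) {n : ℕ} :
    tailWeight lam n = 0 ↔ ∀ j, n ≤ j → lam j = 0 := by
  have tail_hasSum : HasSum (fun j => lam (j + n)) (tailWeight lam n) :=
    (hasSum_nat_add_iff' n).2 hlam.hasSum
  have tail_nonneg (j : ℕ) : 0 ≤ lam (j + n) := hlam.nonneg _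
  constructor
  · intro h j hj
    rw [h, hasSum_zero_iff_of_nonneg tail_nonneg] at tail_hasSum
    simpa [Nat.sub_add_cancel hj] using congrFun tail_hasSum (j - n)
  · intro h
    refine tail_hasSum.unique ?_
    simp only [h _ (Nat.le_add_left n _), hasSum_zero]

theorem finite_support_iff (hlam : IsProbabilityWeight lam) :
    (Function.support lam).Finite ↔ ∃ n, tailWeight lam n = 0 := by
  constructor
  · intro h
    obtain ⟨n, hn⟩ := h.bddAbove
    refine ⟨n + 1, hlam.tailWeight_eq_zero_iff.2 fun j hj => ?_⟩
    by_contra hne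
    exact absurd (hn hne) (by omega)
  · rintro ⟨n, hn⟩
    refine (Finset.range n).finite_toSet.subset fun j hj => ?_
    by_contra hjn
    exact hj (hlam.tailWeight_eq_zero_iff.1 hn j (by simpa using hjn))

end IsProbabilityWeight

/-- I.i.d. nonnegative random variables `ξ 1, ξ 2, …`; nothing is assumed about `ξ 0`. -/
structure IsNonnegNoise {Ω : Type*} [MeasurableSpace Ω] (P : Measure Ω) (ξ : ℕ → Ω → ℝ) :
    Prop where
  meas : ∀ n, 1 ≤ n → Measurable (ξ n)
  nonneg : ∀ n, 1 ≤ n → ∀ᵐ w ∂P, 0 ≤ ξ n w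
  indep : iIndepFun (fun n : ℕ => ξ (n + 1)) P
  ident : ∀ n, 1 ≤ n → IdentDistrib (ξ n) (ξ 1) P P

/-- The bound `φ(t) ≤ c (1 + t) ^ (-β)` for `t ≥ 0`, with `β > 0`. -/
structure HasPowerDecay (φ : ℝ → ℝ) (β c : ℝ) : Prop where
  exponent_pos : 0 < β
  le : ∀ t : ℝ, 0 ≤ t → φ t ≤ c * (1 + t) ^ (-β)

theorem HasPowerDecay.tendsto_zero {φ : ℝ → ℝ} {β c : ℝ} (hφ : HasPowerDecay φ β c)
    (hφ0 : ∀ t, 0 ≤ φ t) : Tendsto φ atTop (𝓝 0) := by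
  have bound_tendsto : Tendsto (fun t : ℝ => c * (1 + t) ^ (-β)) atTop (𝓝 (c * 0)) :=
    ((tendsto_rpow_neg_atTop hφ.exponent_pos).comp
      (tendsto_atTop_add_const_left _ 1 tendsto_id)).const_mul c
  rw [mul_zero] at bound_tendsto
  exact squeeze_zero' (Eventually.of_forall hφ0)
    ((eventually_ge_atTop 0).mono fun t ht => hφ.le t ht) bound_tendsto

section Noise

/-- The contribution `∑_{j ∈ s} λ_j ξ_{n-j}` of the lags in `s` to the moving average at time `n`.
Since `n - j` truncates at `0`, it is meaningful for `s ⊆ {0, …, n - 1}`. -/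
noncomputable def noiseSum {Ω : Type*} (lam : ℕ → ℝ) (ξ : ℕ → Ω → ℝ) (n : ℕ) (s : Finset ℕ)
    (w : Ω) : ℝ :=
  ∑ j ∈ s, lam j * ξ (n - j) w

/-- The part of the moving average at time `n` which comes from `ω₀` and from the lags `j ≥ m`. -/
noncomputable def remotePart {Ω : Type*} (lam : ℕ → ℝ) (ω₀ : ℝ) (ξ : ℕ → Ω → ℝ) (n m : ℕ)
    (w : Ω) : ℝ :=
  tailWeight lam n * ω₀ + noiseSum lam ξ n (Finset.Ico m n) w

variable {Ω : Type*} {ξ : ℕ → Ω → ℝ} {lam : ℕ → ℝ} {ω₀ : ℝ}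

theorem movingAverage_eq_remotePart_zero (n : ℕ) :
    movingAverage lam ω₀ ξ n = remotePart lam ω₀ ξ n 0 := by
  have sum_Icc_lag (g : ℕ → ℕ → ℝ) :
      ∑ k ∈ Finset.Icc 1 n, g (n - k) k = ∑ j ∈ Finset.range n, g j (n - j) := by
    refine Finset.sum_nbij' (fun k => n - k) (fun j => n - j) ?_ ?_ ?_ ?_ ?_ <;>
      intro k hk <;> simp only [Finset.mem_Icc, Finset.mem_range] at hk ⊢
    all_goals first | omega | rw [Nat.sub_sub_self hk.2]
  ext w
  rw [movingAverage, sum_Icc_lag fun j _ => lam j, sum_Icc_lag fun j k => lam j * ξ k w,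
    Finset.range_eq_Ico, remotePart, tailWeight, noiseSum, Finset.range_eq_Ico]

theorem noiseSum_add_remotePart {m n : ℕ} (hmn : m ≤ n) (w : Ω) :
    noiseSum lam ξ n (Finset.range m) w + remotePart lam ω₀ ξ n m w
      = movingAverage lam ω₀ ξ n w := by
  rw [movingAverage_eq_remotePart_zero, remotePart, remotePart, noiseSum, noiseSum, noiseSum,
    add_left_comm, Finset.range_eq_Ico, Finset.sum_Ico_consecutive _ (Nat.zero_le m) hmn]

theorem noiseSum_nonneg (hlam : IsProbabilityWeight lam) {w : Ω} (hw : ∀ i, 0 ≤ ξ (i + 1) w)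
    {n : ℕ} {s : Finset ℕ} (hs : s ⊆ Finset.range n) : 0 ≤ noiseSum lam ξ n s w := by
  refine Finset.sum_nonneg fun j hj => mul_nonneg (hlam.nonneg j) ?_
  simpa only [Nat.sub_add_cancel (Nat.sub_pos_of_lt (Finset.mem_range.1 (hs hj)))] using
    hw (n - j - 1)

theorem remotePart_nonneg (hlam : IsProbabilityWeight lam) (hω₀ : 0 ≤ ω₀) {w : Ω}
    (hw : ∀ i, 0 ≤ ξ (i + 1) w) (n m : ℕ) : 0 ≤ remotePart lam ω₀ ξ n m w :=
  add_nonneg (mul_nonneg (hlam.tailWeight_nonneg n) hω₀)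
    (noiseSum_nonneg hlam hw fun _ hj => Finset.mem_range.2 (Finset.mem_Ico.1 hj).2)

theorem movingAverage_pos (hlam : IsProbabilityWeight lam) (hω₀ : 0 < ω₀) {w : Ω}
    (hw : ∀ i, 0 < ξ (i + 1) w) (n : ℕ) : 0 < movingAverage lam ω₀ ξ n w := by
  have lag_pos (j : ℕ) (hj : j ∈ Finset.range n) : 0 < ξ (n - j) w := by
    simpa only [Nat.sub_add_cancel (Nat.sub_pos_of_lt (Finset.mem_range.1 hj))] using hw (n - j - 1)
  rw [movingAverage_eq_remotePart_zero, remotePart, ← Finset.range_eq_Ico]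
  rcases (hlam.tailWeight_nonneg n).eq_or_lt with h | h
  · have sum_eq_one : ∑ j ∈ Finset.range n, lam j = 1 := (sub_eq_zero.1 h.symm).symm
    obtain ⟨j, hj, hne⟩ := Finset.exists_ne_zero_of_sum_ne_zero (sum_eq_one ▸ one_ne_zero)
    rw [← h, zero_mul, zero_add, noiseSum]
    exact Finset.sum_pos' (fun i hi => mul_nonneg (hlam.nonneg i) (lag_pos i hi).le)
      ⟨j, hj, mul_pos ((hlam.nonneg j).lt_of_ne' hne) (lag_pos j hj)⟩
  · exact add_pos_of_pos_of_nonneg (mul_pos h hω₀)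
      (Finset.sum_nonneg fun i hi => mul_nonneg (hlam.nonneg i) (lag_pos i hi).le)

variable {mΩ : MeasurableSpace Ω}

theorem measurable_noiseSum {n : ℕ} {s : Finset ℕ} (h : ∀ j ∈ s, Measurable (ξ (n - j))) :
    Measurable (noiseSum lam ξ n s) :=
  Finset.measurable_fun_sum _ fun j hj => (h j hj).const_mul _

theorem measurable_remotePart {n m : ℕ} (h : ∀ k, 1 ≤ k → k ≤ n → Measurable (ξ k)) :
    Measurable (remotePart lam ω₀ ξ n m) :=
  (measurable_noiseSum fun j hj => h _ (Nat.sub_pos_of_lt (Finset.mem_Ico.1 hj).2)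
    (Nat.sub_le n j)).const_add _

theorem measurable_movingAverage {n : ℕ} (h : ∀ k, 1 ≤ k → k ≤ n → Measurable (ξ k)) :
    Measurable (movingAverage lam ω₀ ξ n) :=
  movingAverage_eq_remotePart_zero (lam := lam) n ▸ measurable_remotePart h

variable {P : Measure Ω}

namespace IsNonnegNoise

theorem ae_pos [IsFiniteMeasure P] (hξ : IsNonnegNoise P ξ)
    (hlim : Tendsto (rvLaplace P (ξ 1)) atTop (𝓝 0)) : ∀ᵐ w ∂P, ∀ i : ℕ, 0 < ξ (i + 1) w :=
  ae_all_iff.2 fun i => (hξ.ident (i + 1) (Nat.le_add_left 1 i)).symm.ae_snd measurableSet_Ioi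
    (ae_pos_of_tendsto_rvLaplace_zero (hξ.meas 1 le_rfl) (hξ.nonneg 1 le_rfl) hlim)

theorem ae_nonneg (hξ : IsNonnegNoise P ξ) : ∀ᵐ w ∂P, ∀ i : ℕ, 0 ≤ ξ (i + 1) w :=
  ae_all_iff.2 fun i => hξ.nonneg (i + 1) (Nat.le_add_left 1 i)

theorem rvLaplace_noiseSum (hξ : IsNonnegNoise P ξ) {n : ℕ} {s : Finset ℕ}
    (hs : s ⊆ Finset.range n) (t : ℝ) :
    rvLaplace P (noiseSum lam ξ n s) t = ∏ j ∈ s, rvLaplace P (ξ 1) (lam j * t) := by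
  have lag_pos (j : s) : 1 ≤ n - j := Nat.sub_pos_of_lt (Finset.mem_range.1 (hs j.2))
  have lag_injective : Function.Injective fun j : s => n - j - 1 := fun i j hij => by
    have := lag_pos i
    have := lag_pos j
    exact Subtype.ext (by simp only at hij; omega)
  have indep_lags : iIndepFun (fun j : s => ξ (n - j)) P := by
    simpa only [Nat.sub_add_cancel (lag_pos _)] using hξ.indep.precomp lag_injective
  have indep_terms : iIndepFun (fun (j : s) w => lam j * ξ (n - j) w) P :=
    indep_lags.comp (fun j x => lam j * x) fun j => measurable_const_mul _
  have sum_eq : noiseSum lam ξ n s = ∑ j : s, fun w => lam j * ξ (n - j) w := by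
    ext w
    rw [Finset.sum_apply, noiseSum, Finset.sum_coe_sort s fun j => lam j * ξ (n - j) w]
  rw [rvLaplace_eq_mgf, sum_eq, indep_terms.mgf_sum fun j => (hξ.meas _ (lag_pos j)).const_mul _,
    ← Finset.prod_coe_sort s]
  refine Finset.prod_congr rfl fun j _ => ?_
  rw [← rvLaplace_eq_mgf, rvLaplace_const_mul,
    rvLaplace_congr_identDistrib (hξ.ident _ (lag_pos j))]

theorem rvLaplace_remotePart (hξ : IsNonnegNoise P ξ) (n m : ℕ) (t : ℝ) :
    rvLaplace P (remotePart lam ω₀ ξ n m) t = Real.exp (-(tailWeight lam n * ω₀) * t) *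
      ∏ j ∈ Finset.Ico m n, rvLaplace P (ξ 1) (lam j * t) := by
  rw [← hξ.rvLaplace_noiseSum fun j hj => Finset.mem_range.2 (Finset.mem_Ico.1 hj).2]
  exact rvLaplace_const_add _ t

theorem rvLaplace_movingAverage (hξ : IsNonnegNoise P ξ) (n : ℕ) (t : ℝ) :
    rvLaplace P (movingAverage lam ω₀ ξ n) t = Real.exp (-(tailWeight lam n * ω₀) * t) *
      ∏ j ∈ Finset.range n, rvLaplace P (ξ 1) (lam j * t) := by
  rw [movingAverage_eq_remotePart_zero, hξ.rvLaplace_remotePart, Finset.range_eq_Ico]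

variable [IsProbabilityMeasure P]

theorem rvLaplace_mul_le_one (hξ : IsNonnegNoise P ξ) (hlam : IsProbabilityWeight lam) {t : ℝ}
    (ht : 0 ≤ t) (j : ℕ) : rvLaplace P (ξ 1) (lam j * t) ≤ 1 :=
  rvLaplace_le_one (hξ.meas 1 le_rfl) (hξ.nonneg 1 le_rfl) (mul_nonneg (hlam.nonneg j) ht)

theorem multipliable_rvLaplace (hξ : IsNonnegNoise P ξ) (hlam : IsProbabilityWeight lam)
    (hsum : Summable fun n => 1 - rvLaplace P (ξ 1) (lam n)) {t : ℝ} (ht : 0 ≤ t) :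
    Multipliable fun j => rvLaplace P (ξ 1) (lam j * t) := by
  have defect_summable : Summable fun j => ‖rvLaplace P (ξ 1) (lam j * t) - 1‖ := by
    refine (hsum.mul_left (1 + t)).of_nonneg_of_le (fun _ => norm_nonneg _) fun j => ?_
    rw [norm_sub_rev, Real.norm_of_nonneg (sub_nonneg.2 (hξ.rvLaplace_mul_le_one hlam ht j))]
    exact one_sub_rvLaplace_mul_le (hξ.meas 1 le_rfl) (hξ.nonneg 1 le_rfl) (hlam.nonneg j) ht
  simpa only [add_sub_cancel] using multipliable_one_add_of_summable defect_summable

theorem tendsto_rvLaplace_movingAverage (hξ : IsNonnegNoise P ξ) (hlam : IsProbabilityWeight lam)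
    (hsum : Summable fun n => 1 - rvLaplace P (ξ 1) (lam n)) {t : ℝ} (ht : 0 ≤ t) :
    Tendsto (fun n => rvLaplace P (movingAverage lam ω₀ ξ n) t) atTop
      (𝓝 (∏' j, rvLaplace P (ξ 1) (lam j * t))) := by
  have exp_tendsto : Tendsto (fun n => Real.exp (-(tailWeight lam n * ω₀) * t)) atTop (𝓝 1) := by
    simpa using ((hlam.tendsto_tailWeight.mul_const ω₀).neg.mul_const t).rexp
  simpa only [hξ.rvLaplace_movingAverage, one_mul] using
    exp_tendsto.mul (hξ.multipliable_rvLaplace hlam hsum ht).hasProd.tendsto_prod_nat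

theorem rvLaplace_movingAverage_eq_tprod (hξ : IsNonnegNoise P ξ) (hlam : IsProbabilityWeight lam)
    {n : ℕ} (hn : tailWeight lam n = 0) (t : ℝ) :
    rvLaplace P (movingAverage lam ω₀ ξ n) t = ∏' j, rvLaplace P (ξ 1) (lam j * t) := by
  rw [hξ.rvLaplace_movingAverage, hn, tprod_eq_prod (s := Finset.range n)]
  · rw [zero_mul, neg_zero, zero_mul, Real.exp_zero, one_mul]
  · intro j hj
    rw [hlam.tailWeight_eq_zero_iff.1 hn j (by simpa using hj), zero_mul, rvLaplace_zero]

theorem rvLaplace_movingAverage_le_exp (hξ : IsNonnegNoise P ξ) (hlam : IsProbabilityWeight lam)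
    (n : ℕ) {t : ℝ} (ht : 0 ≤ t) :
    rvLaplace P (movingAverage lam ω₀ ξ n) t ≤ Real.exp (-(tailWeight lam n * ω₀) * t) := by
  rw [hξ.rvLaplace_movingAverage]
  exact mul_le_of_le_one_right (Real.exp_pos _).le (Finset.prod_le_one
    (fun j _ => rvLaplace_nonneg _) fun j _ => hξ.rvLaplace_mul_le_one hlam ht j)

theorem rvLaplace_movingAverage_le_prod (hξ : IsNonnegNoise P ξ) (hlam : IsProbabilityWeight lam)
    (hω₀ : 0 ≤ ω₀) {n : ℕ} {J : Finset ℕ} (hJ : J ⊆ Finset.range n) {t : ℝ} (ht : 0 ≤ t) :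
    rvLaplace P (movingAverage lam ω₀ ξ n) t ≤ ∏ j ∈ J, rvLaplace P (ξ 1) (lam j * t) := by
  have exp_le_one : Real.exp (-(tailWeight lam n * ω₀) * t) ≤ 1 := Real.exp_le_one_iff.2
    (mul_nonpos_of_nonpos_of_nonneg
      (neg_nonpos.2 (mul_nonneg (hlam.tailWeight_nonneg n) hω₀)) ht)
  rw [hξ.rvLaplace_movingAverage]
  exact (mul_le_of_le_one_left (Finset.prod_nonneg fun j _ => rvLaplace_nonneg _) exp_le_one).trans
    (Finset.prod_le_prod_of_subset_of_le_one hJ (fun j _ => rvLaplace_nonneg _)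
      fun j _ _ => hξ.rvLaplace_mul_le_one hlam ht j)

end IsNonnegNoise

namespace HasPowerDecay

variable {φ : ℝ → ℝ} {β c : ℝ}

theorem const_nonneg (hφ : HasPowerDecay φ β c) (hφ0 : 0 ≤ φ 0) : 0 ≤ c := by
  simpa using hφ0.trans (hφ.le 0 le_rfl)

theorem mul_le (hφ : HasPowerDecay φ β c) (hφ0 : 0 ≤ φ 0) {s t : ℝ} (hs : 0 < s) (hs1 : s ≤ 1)
    (ht : 0 ≤ t) : φ (s * t) ≤ c * s ^ (-β) * (1 + t) ^ (-β) := by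
  have base_le : s * (1 + t) ≤ 1 + s * t := by linarith
  have base_pos : 0 < s * (1 + t) := mul_pos hs (by linarith)
  calc φ (s * t) ≤ c * (1 + s * t) ^ (-β) := hφ.le _ (mul_nonneg hs.le ht)
    _ ≤ c * (s * (1 + t)) ^ (-β) :=
        mul_le_mul_of_nonneg_left (Real.rpow_le_rpow_of_nonpos base_pos base_le
          (neg_nonpos.2 hφ.exponent_pos.le)) (hφ.const_nonneg hφ0)
    _ = c * s ^ (-β) * (1 + t) ^ (-β) := by rw [Real.mul_rpow hs.le (by linarith), mul_assoc]

theorem prod_mul_le (hφ : HasPowerDecay φ β c) (hφ0 : ∀ t, 0 ≤ φ t) (hlam : IsProbabilityWeight lam)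
    {J : Finset ℕ} (hJ : ∀ j ∈ J, lam j ≠ 0) {t : ℝ} (ht : 0 ≤ t) :
    ∏ j ∈ J, φ (lam j * t) ≤ (∏ j ∈ J, c * lam j ^ (-β)) * (1 + t) ^ (-(β * J.card)) := by
  calc ∏ j ∈ J, φ (lam j * t) ≤ ∏ j ∈ J, (c * lam j ^ (-β)) * (1 + t) ^ (-β) :=
        Finset.prod_le_prod (fun j _ => hφ0 _) fun j hj =>
          hφ.mul_le (hφ0 0) ((hlam.nonneg j).lt_of_ne' (hJ j hj)) (hlam.le_one j) ht
    _ = _ := by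
        rw [Finset.prod_mul_distrib, Finset.prod_const, ← Real.rpow_natCast,
          ← Real.rpow_mul (by linarith), neg_mul]

end HasPowerDecay

theorem IsNonnegNoise.exists_rvLaplace_movingAverage_le [IsProbabilityMeasure P] {β c : ℝ}
    (hξ : IsNonnegNoise P ξ) (hφ : HasPowerDecay (rvLaplace P (ξ 1)) β c)
    (hlam : IsProbabilityWeight lam) (hω₀ : 0 ≤ ω₀) (hinf : (Function.support lam).Infinite)
    (M : ℝ) :
    ∃ n₀ : ℕ, ∃ D : ℝ, ∀ n, n₀ ≤ n → ∀ t : ℝ, 0 ≤ t →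
      rvLaplace P (movingAverage lam ω₀ ξ n) t ≤ D * (1 + t) ^ (-M) := by
  obtain ⟨L, hL⟩ := exists_nat_ge (M / β)
  obtain ⟨J, hJ, rfl⟩ := hinf.exists_subset_card_eq L
  obtain ⟨n₀, hn₀⟩ := J.exists_nat_subset_range
  have const_nonneg : 0 ≤ ∏ j ∈ J, c * lam j ^ (-β) := Finset.prod_nonneg fun j _ =>
    mul_nonneg (hφ.const_nonneg (rvLaplace_nonneg 0)) (Real.rpow_nonneg (hlam.nonneg j) _)
  refine ⟨n₀, ∏ j ∈ J, c * lam j ^ (-β), fun n hn t ht => ?_⟩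
  calc rvLaplace P (movingAverage lam ω₀ ξ n) t
      ≤ ∏ j ∈ J, rvLaplace P (ξ 1) (lam j * t) :=
        hξ.rvLaplace_movingAverage_le_prod hlam hω₀ (hn₀.trans (Finset.range_mono hn)) ht
    _ ≤ (∏ j ∈ J, c * lam j ^ (-β)) * (1 + t) ^ (-(β * J.card)) :=
        hφ.prod_mul_le rvLaplace_nonneg hlam (fun j hj => hJ hj) ht
    _ ≤ _ := mul_le_mul_of_nonneg_left (Real.rpow_le_rpow_of_exponent_le (by linarith)
        (neg_le_neg ((div_le_iff₀' hφ.exponent_pos).1 hL))) const_nonneg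

end Noise

section SecondMoment

theorem integrableOn_exp_neg_mul {g : ℝ → ℝ} (hg : IntegrableOn g (Set.Ioi 0)) {ε : ℝ}
    (hε : 0 ≤ ε) : IntegrableOn (fun t => Real.exp (-ε * t) * g t) (Set.Ioi 0) := by
  refine Integrable.bdd_mul (c := 1) hg (by fun_prop) ?_
  filter_upwards [ae_restrict_mem measurableSet_Ioi] with t (ht : 0 < t)
  rw [Real.norm_of_nonneg (Real.exp_pos _).le, Real.exp_le_one_iff, neg_mul, neg_nonpos]
  exact mul_nonneg hε ht.le

theorem tendsto_setIntegral_exp_neg_mul {g : ℝ → ℝ} (hg : IntegrableOn g (Set.Ioi 0)) :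
    Tendsto (fun ε : ℝ => ∫ t in Set.Ioi 0, Real.exp (-ε * t) * g t) (𝓝[>] 0)
      (𝓝 (∫ t in Set.Ioi 0, g t)) := by
  refine tendsto_integral_filter_of_dominated_convergence (fun t => ‖g t‖) ?_ ?_ hg.norm ?_
  · filter_upwards [self_mem_nhdsWithin] with ε (hε : 0 < ε)
    exact (integrableOn_exp_neg_mul hg hε.le).aestronglyMeasurable
  · filter_upwards [self_mem_nhdsWithin] with ε (hε : 0 < ε)
    filter_upwards [ae_restrict_mem measurableSet_Ioi] with t (ht : 0 < t)
    rw [norm_mul, Real.norm_of_nonneg (Real.exp_pos _).le]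
    refine mul_le_of_le_one_left (norm_nonneg _) (Real.exp_le_one_iff.2 ?_)
    exact mul_nonpos_of_nonpos_of_nonneg (neg_nonpos.2 hε.le) ht.le
  · refine ae_of_all _ fun t => Tendsto.mono_left ?_ nhdsWithin_le_nhds
    have integrand_continuous : Continuous fun ε : ℝ => Real.exp (-ε * t) * g t := by fun_prop
    simpa using integrand_continuous.tendsto 0

variable {Ω : Type*} {mΩ : MeasurableSpace Ω} {P : Measure Ω} [IsProbabilityMeasure P]
  {F f : ℝ → ℝ} {X : Ω → ℝ}

theorem IsPolyLaplace.memLp_and_integral_sq_comp_const_add (hF : IsPolyLaplace F f)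
    (hX : Measurable X) (hpos : ∀ᵐ w ∂P, 0 < X w)
    (hint : IntegrableOn (fun t => selfConv f t * rvLaplace P X t) (Set.Ioi 0)) {ε : ℝ}
    (hε : 0 ≤ ε) :
    MemLp (fun w => laplaceTransform f (ε + X w)) 2 P ∧
      ∫ w, laplaceTransform f (ε + X w) ^ 2 ∂P
        = ∫ t in Set.Ioi 0, Real.exp (-ε * t) * (selfConv f t * rvLaplace P X t) := by
  have integrand_eq (t : ℝ) : selfConv f t * rvLaplace P (fun w => ε + X w) t
      = Real.exp (-ε * t) * (selfConv f t * rvLaplace P X t) := by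
    rw [rvLaplace_const_add, mul_left_comm]
  simp only [← integrand_eq]
  refine hF.memLp_and_integral_sq_comp (hX.const_add ε)
    (hpos.mono fun w hw => add_pos_of_nonneg_of_pos hε hw) ?_
  simpa only [integrand_eq] using integrableOn_exp_neg_mul hint hε

variable {ξ : ℕ → Ω → ℝ} {lam : ℕ → ℝ} {ω₀ β c : ℝ}

namespace IsNonnegNoise

theorem tendsto_selfConv_mul_rvLaplace (hξ : IsNonnegNoise P ξ) (hlam : IsProbabilityWeight lam)
    (hsum : Summable fun n => 1 - rvLaplace P (ξ 1) (lam n)) {t : ℝ} (ht : 0 ≤ t) :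
    Tendsto (fun n => selfConv f t * rvLaplace P (movingAverage lam ω₀ ξ n) t) atTop
      (𝓝 (varianceIntegrand f (rvLaplace P (ξ 1)) lam t)) :=
  (hξ.tendsto_rvLaplace_movingAverage hlam hsum ht).const_mul _

theorem integrableOn_selfConv_mul_rvLaplace (hξ : IsNonnegNoise P ξ)
    (hlam : IsProbabilityWeight lam) (hF : IsPolyLaplace F f) (hω₀ : 0 < ω₀)
    (hfin : (Function.support lam).Finite →
      IntegrableOn (varianceIntegrand f (rvLaplace P (ξ 1)) lam) (Set.Ioi 0)) (n : ℕ) :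
    IntegrableOn (fun t => selfConv f t * rvLaplace P (movingAverage lam ω₀ ξ n) t)
      (Set.Ioi 0) := by
  rcases (hlam.tailWeight_nonneg n).eq_or_lt with h | h
  · refine (hfin (hlam.finite_support_iff.2 ⟨n, h.symm⟩)).congr_fun (fun t _ => ?_)
      measurableSet_Ioi
    rw [varianceIntegrand, hξ.rvLaplace_movingAverage_eq_tprod hlam h.symm]
  · have average_meas : Measurable (movingAverage lam ω₀ ξ n) :=
      measurable_movingAverage fun k hk _ => hξ.meas k hk
    refine Integrable.mono' (hF.integrableOn_exp_mul_selfConv (mul_pos h hω₀))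
      (hF.aestronglyMeasurable_selfConv.mul
        (measurable_rvLaplace average_meas).aestronglyMeasurable) ?_
    filter_upwards [ae_restrict_mem measurableSet_Ioi] with t (ht : 0 < t)
    have selfConv_nonneg := selfConv_nonneg hF.nonneg_right ht.le
    rw [Real.norm_of_nonneg (mul_nonneg selfConv_nonneg (rvLaplace_nonneg t)), mul_comm]
    exact mul_le_mul_of_nonneg_right (hξ.rvLaplace_movingAverage_le_exp hlam n ht.le)
      selfConv_nonneg

theorem exists_integrableOn_bound (hξ : IsNonnegNoise P ξ)
    (hφ : HasPowerDecay (rvLaplace P (ξ 1)) β c) (hlam : IsProbabilityWeight lam)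
    (hF : IsPolyLaplace F f) (hω₀ : 0 ≤ ω₀)
    (hfin : (Function.support lam).Finite →
      IntegrableOn (varianceIntegrand f (rvLaplace P (ξ 1)) lam) (Set.Ioi 0)) :
    ∃ n₀ : ℕ, ∃ b : ℝ → ℝ, IntegrableOn b (Set.Ioi 0) ∧ ∀ n, n₀ ≤ n → ∀ t : ℝ, 0 < t →
      ‖selfConv f t * rvLaplace P (movingAverage lam ω₀ ξ n) t‖ ≤ b t := by
  suffices ∃ n₀ : ℕ, ∃ b : ℝ → ℝ, IntegrableOn b (Set.Ioi 0) ∧ ∀ n, n₀ ≤ n → ∀ t : ℝ, 0 < t →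
      selfConv f t * rvLaplace P (movingAverage lam ω₀ ξ n) t ≤ b t by
    obtain ⟨n₀, b, b_int, hb⟩ := this
    refine ⟨n₀, b, b_int, fun n hn t ht => ?_⟩
    rw [Real.norm_of_nonneg
      (mul_nonneg (selfConv_nonneg hF.nonneg_right ht.le) (rvLaplace_nonneg t))]
    exact hb n hn t ht
  by_cases hs : (Function.support lam).Finite
  · obtain ⟨n₀, hn₀⟩ := hlam.finite_support_iff.1 hs
    refine ⟨n₀, _, hfin hs, fun n hn t _ => ?_⟩
    have tail_eq_zero : tailWeight lam n = 0 :=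
      ((hlam.antitone_tailWeight hn).trans_eq hn₀).antisymm (hlam.tailWeight_nonneg n)
    rw [varianceIntegrand, hξ.rvLaplace_movingAverage_eq_tprod hlam tail_eq_zero]
  · obtain ⟨M, -, hM⟩ := hF.exists_integrableOn_rpow_mul_selfConv
    obtain ⟨n₀, D, hbound⟩ := hξ.exists_rvLaplace_movingAverage_le hφ hlam hω₀ hs M
    refine ⟨n₀, _, hM.const_mul D, fun n hn t ht => ?_⟩
    calc selfConv f t * rvLaplace P (movingAverage lam ω₀ ξ n) t
        ≤ selfConv f t * (D * (1 + t) ^ (-M)) :=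
          mul_le_mul_of_nonneg_left (hbound n hn t ht.le) (selfConv_nonneg hF.nonneg_right ht.le)
      _ = D * ((1 + t) ^ (-M) * selfConv f t) := by ring

theorem integrableOn_varianceIntegrand (hξ : IsNonnegNoise P ξ)
    (hφ : HasPowerDecay (rvLaplace P (ξ 1)) β c) (hlam : IsProbabilityWeight lam)
    (hsum : Summable fun n => 1 - rvLaplace P (ξ 1) (lam n)) (hF : IsPolyLaplace F f)
    (hfin : (Function.support lam).Finite →
      IntegrableOn (varianceIntegrand f (rvLaplace P (ξ 1)) lam) (Set.Ioi 0)) :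
    IntegrableOn (varianceIntegrand f (rvLaplace P (ξ 1)) lam) (Set.Ioi 0) := by
  obtain ⟨n₀, b, b_int, hb⟩ := hξ.exists_integrableOn_bound hφ hlam hF zero_le_one hfin
  have integrand_meas (n : ℕ) : AEStronglyMeasurable
      (fun t => selfConv f t * rvLaplace P (movingAverage lam 1 ξ n) t)
      (volume.restrict (Set.Ioi 0)) :=
    hF.aestronglyMeasurable_selfConv.mul (measurable_rvLaplace
      (measurable_movingAverage fun k hk _ => hξ.meas k hk)).aestronglyMeasurable
  have pointwise_lim : ∀ᵐ t ∂volume.restrict (Set.Ioi 0),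
      Tendsto (fun n => selfConv f t * rvLaplace P (movingAverage lam 1 ξ n) t) atTop
        (𝓝 (varianceIntegrand f (rvLaplace P (ξ 1)) lam t)) := by
    filter_upwards [ae_restrict_mem measurableSet_Ioi] with t (ht : 0 < t)
    exact hξ.tendsto_selfConv_mul_rvLaplace hlam hsum ht.le
  refine b_int.mono' (aestronglyMeasurable_of_tendsto_ae atTop integrand_meas pointwise_lim) ?_
  filter_upwards [ae_restrict_mem measurableSet_Ioi, pointwise_lim] with t (ht : 0 < t) hlim
  exact le_of_tendsto hlim.norm ((eventually_ge_atTop n₀).mono fun n hn => hb n hn t ht)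

theorem tendsto_integral_exp_mul_selfConv_mul_rvLaplace (hξ : IsNonnegNoise P ξ)
    (hφ : HasPowerDecay (rvLaplace P (ξ 1)) β c) (hlam : IsProbabilityWeight lam)
    (hsum : Summable fun n => 1 - rvLaplace P (ξ 1) (lam n)) (hF : IsPolyLaplace F f)
    (hω₀ : 0 < ω₀)
    (hfin : (Function.support lam).Finite →
      IntegrableOn (varianceIntegrand f (rvLaplace P (ξ 1)) lam) (Set.Ioi 0))
    {ε : ℝ} (hε : 0 ≤ ε) :
    Tendsto (fun n => ∫ t in Set.Ioi 0, Real.exp (-ε * t) *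
        (selfConv f t * rvLaplace P (movingAverage lam ω₀ ξ n) t)) atTop
      (𝓝 (∫ t in Set.Ioi 0,
        Real.exp (-ε * t) * varianceIntegrand f (rvLaplace P (ξ 1)) lam t)) := by
  obtain ⟨n₀, b, b_int, hb⟩ := hξ.exists_integrableOn_bound hφ hlam hF hω₀.le hfin
  refine tendsto_integral_filter_of_dominated_convergence (fun t => Real.exp (-ε * t) * b t)
    (Eventually.of_forall fun n => (integrableOn_exp_neg_mul
      (hξ.integrableOn_selfConv_mul_rvLaplace hlam hF hω₀ hfin n) hε).aestronglyMeasurable) ?_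
    (integrableOn_exp_neg_mul b_int hε) ?_
  · filter_upwards [eventually_ge_atTop n₀] with n hn
    filter_upwards [ae_restrict_mem measurableSet_Ioi] with t (ht : 0 < t)
    rw [norm_mul, Real.norm_of_nonneg (Real.exp_pos _).le]
    exact mul_le_mul_of_nonneg_left (hb n hn t ht) (Real.exp_pos _).le
  · filter_upwards [ae_restrict_mem measurableSet_Ioi] with t (ht : 0 < t)
    exact (hξ.tendsto_selfConv_mul_rvLaplace hlam hsum ht.le).const_mul _

end IsNonnegNoise

end SecondMoment

section Mixing

theorem one_sub_prod_le_sum {ι : Type*} {s : Finset ι} {a : ι → ℝ} (h0 : ∀ i ∈ s, 0 ≤ a i)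
    (h1 : ∀ i ∈ s, a i ≤ 1) : 1 - ∏ i ∈ s, a i ≤ ∑ i ∈ s, (1 - a i) := by
  induction s using Finset.cons_induction with
  | empty => simp
  | cons i s hi ih =>
    rw [Finset.forall_mem_cons] at h0 h1
    rw [Finset.prod_cons, Finset.sum_cons]
    have prod_le_one : ∏ j ∈ s, a j ≤ 1 := Finset.prod_le_one h0.2 h1.2
    calc 1 - a i * ∏ j ∈ s, a j = (1 - a i) + a i * (1 - ∏ j ∈ s, a j) := by ring
      _ ≤ (1 - a i) + (1 - ∏ j ∈ s, a j) :=
          add_le_add_right (mul_le_of_le_one_left (sub_nonneg.2 prod_le_one) h1.1) _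
      _ ≤ (1 - a i) + ∑ j ∈ s, (1 - a j) := add_le_add_right (ih h0.2 h1.2) _

theorem IsPolyLaplace.exists_sq_laplaceTransform_sub_le {F f : ℝ → ℝ} (hF : IsPolyLaplace F f)
    {ε : ℝ} (hε : 0 < ε) :
    ∃ C, 0 ≤ C ∧ ∀ x r : ℝ, 0 ≤ x → 0 ≤ r →
      |laplaceTransform f (ε + (x + r)) ^ 2 - laplaceTransform f (ε + x) ^ 2|
        ≤ C * (1 - Real.exp (-r)) := by
  obtain ⟨C, hC, sub_le⟩ := hF.exists_laplaceTransform_sub_le hε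
  refine ⟨2 * laplaceTransform f ε * C,
    mul_nonneg (mul_nonneg zero_le_two (hF.laplaceTransform_nonneg ε)) hC, fun x r hx hr => ?_⟩
  set a := laplaceTransform f (ε + x)
  set b := laplaceTransform f (ε + (x + r))
  have b_nonneg : 0 ≤ b := hF.laplaceTransform_nonneg _
  have b_le_a : b ≤ a := hF.antitoneOn_laplaceTransform (Set.mem_Ioi.2 (by linarith))
    (Set.mem_Ioi.2 (by linarith)) (by linarith)
  have a_le : a ≤ laplaceTransform f ε := hF.antitoneOn_laplaceTransform (Set.mem_Ioi.2 hε)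
    (Set.mem_Ioi.2 (by linarith)) (by linarith)
  calc |b ^ 2 - a ^ 2| = (a + b) * (a - b) := by
        rw [abs_sub_comm, abs_of_nonneg (sub_nonneg.2 (pow_le_pow_left₀ b_nonneg b_le_a 2))]
        ring
    _ ≤ (2 * laplaceTransform f ε) * (C * (1 - Real.exp (-r))) :=
        mul_le_mul (by linarith) (sub_le x r hx hr) (sub_nonneg.2 b_le_a) (by linarith)
    _ = 2 * laplaceTransform f ε * C * (1 - Real.exp (-r)) := by ring

/-- A bound for the influence on the moving average of `ω₀` and of the noise at lags `≥ m`, where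
`φ` is the Laplace transform of the noise. -/
noncomputable def mixingRate (lam : ℕ → ℝ) (ω₀ : ℝ) (φ : ℝ → ℝ) (m : ℕ) : ℝ :=
  tailWeight lam m * ω₀ + ∑' k, (1 - φ (lam (k + m)))

variable {lam : ℕ → ℝ} {ω₀ : ℝ}

theorem IsProbabilityWeight.tendsto_mixingRate (hlam : IsProbabilityWeight lam) (φ : ℝ → ℝ) :
    Tendsto (mixingRate lam ω₀ φ) atTop (𝓝 0) := by
  have tendsto_add :=
    (hlam.tendsto_tailWeight.mul_const ω₀).add (tendsto_sum_nat_add fun k => 1 - φ (lam k))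
  rwa [zero_mul, zero_add] at tendsto_add

variable {Ω : Type*} {mΩ : MeasurableSpace Ω} {P : Measure Ω} {ξ : ℕ → Ω → ℝ}

/-- The weights `F(ε + |ω_n|)`, with `F` the Laplace transform of `f`. For `ε > 0` they are
bounded; the absolute value keeps `ω_n` nonnegative on the null set where the noise may not be. -/
noncomputable def shiftedWeight (f : ℝ → ℝ) (lam : ℕ → ℝ) (ω₀ : ℝ) (ξ : ℕ → Ω → ℝ) (ε : ℝ) (n : ℕ)
    (w : Ω) : ℝ :=
  laplaceTransform f (ε + |movingAverage lam ω₀ ξ n w|)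

theorem measurable_shiftedWeight {F f : ℝ → ℝ} (hF : IsPolyLaplace F f) {ε : ℝ} {n : ℕ}
    (h : ∀ k, 1 ≤ k → k ≤ n → Measurable (ξ k)) : Measurable (shiftedWeight f lam ω₀ ξ ε n) :=
  hF.measurable_laplaceTransform.comp
    ((measurable_norm.comp (measurable_movingAverage h)).const_add ε)

theorem abs_shiftedWeight_le {F f : ℝ → ℝ} (hF : IsPolyLaplace F f) {ε : ℝ} (hε : 0 < ε) (n : ℕ)
    (w : Ω) : |shiftedWeight f lam ω₀ ξ ε n w| ≤ laplaceTransform f ε := by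
  have arg_ge : ε ≤ ε + |movingAverage lam ω₀ ξ n w| := le_add_of_nonneg_right (abs_nonneg _)
  rw [shiftedWeight, abs_of_nonneg (hF.laplaceTransform_nonneg _)]
  exact hF.antitoneOn_laplaceTransform (Set.mem_Ioi.2 hε) (Set.mem_Ioi.2 (hε.trans_le arg_ge))
    arg_ge

namespace IsNonnegNoise

theorem indepFun_movingAverage_noiseSum (hξ : IsNonnegNoise P ξ) (i m : ℕ) :
    IndepFun (movingAverage lam ω₀ ξ i) (noiseSum lam ξ (i + m) (Finset.range m)) P := by
  let 𝓜 (k : ℕ) : MeasurableSpace Ω := (inferInstance : MeasurableSpace ℝ).comap (ξ (k + 1))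
  have indep_past_future : Indep (⨆ k ∈ Set.Iio i, 𝓜 k) (⨆ k ∈ Set.Ici i, 𝓜 k) P :=
    indep_iSup_of_disjoint (fun k => (hξ.meas (k + 1) (Nat.le_add_left 1 k)).comap_le) hξ.indep
      (Set.disjoint_left.2 fun k hk hk' => (Set.mem_Iio.1 hk).not_ge hk')
  have noise_meas {s : Set ℕ} {k : ℕ} (hk : 1 ≤ k) (hks : k - 1 ∈ s) :
      Measurable[⨆ l ∈ s, 𝓜 l] (ξ k) := by
    obtain ⟨l, rfl⟩ := Nat.exists_eq_add_of_le' hk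
    exact (comap_measurable (ξ (l + 1))).mono (le_iSup₂ (f := fun l _ => 𝓜 l) l hks) le_rfl
  rw [IndepFun_iff_Indep]
  refine indep_of_indep_of_le_left (indep_of_indep_of_le_right indep_past_future ?_) ?_
  · refine (measurable_noiseSum fun j hj => ?_).comap_le
    have := Finset.mem_range.1 hj
    exact noise_meas (by omega) (Set.mem_Ici.2 (by omega))
  · exact (measurable_movingAverage fun k hk hki =>
      noise_meas hk (Set.mem_Iio.2 (by omega))).comap_le

variable [IsProbabilityMeasure P]

theorem integral_one_sub_exp_remotePart_le (hξ : IsNonnegNoise P ξ)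
    (hlam : IsProbabilityWeight lam) (hsum : Summable fun n => 1 - rvLaplace P (ξ 1) (lam n))
    (hω₀ : 0 ≤ ω₀) {m n : ℕ} (hmn : m ≤ n) :
    ∫ w, (1 - Real.exp (-remotePart lam ω₀ ξ n m w)) ∂P
      ≤ mixingRate lam ω₀ (rvLaplace P (ξ 1)) m := by
  set φ := rvLaplace P (ξ 1)
  have φ_le_one (j : ℕ) : φ (lam j) ≤ 1 := by simpa using hξ.rvLaplace_mul_le_one hlam zero_le_one j
  have drift_le : tailWeight lam n * ω₀ ≤ tailWeight lam m * ω₀ :=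
    mul_le_mul_of_nonneg_right (hlam.antitone_tailWeight hmn) hω₀
  have drift_nonneg : 0 ≤ tailWeight lam n * ω₀ := mul_nonneg (hlam.tailWeight_nonneg n) hω₀
  have sum_le_tsum : ∑ j ∈ Finset.Ico m n, (1 - φ (lam j)) ≤ ∑' k, (1 - φ (lam (k + m))) := by
    rw [Finset.sum_Ico_eq_sum_range]
    simpa only [add_comm m] using ((summable_nat_add_iff m).2 hsum).sum_le_tsum
      (Finset.range (n - m)) fun k _ => sub_nonneg.2 (φ_le_one (k + m))
  have prod_le_one : ∏ j ∈ Finset.Ico m n, φ (lam j) ≤ 1 :=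
    Finset.prod_le_one (fun j _ => rvLaplace_nonneg _) fun j _ => φ_le_one j
  have integral_eq : ∫ w, (1 - Real.exp (-remotePart lam ω₀ ξ n m w)) ∂P
      = 1 - Real.exp (-(tailWeight lam n * ω₀)) * ∏ j ∈ Finset.Ico m n, φ (lam j) := by
    have remote_nonneg : ∀ᵐ w ∂P, 0 ≤ remotePart lam ω₀ ξ n m w :=
      hξ.ae_nonneg.mono fun w hw => remotePart_nonneg hlam hω₀ hw n m
    have := one_sub_rvLaplace_eq_integral
      (measurable_remotePart fun k hk _ => hξ.meas k hk) remote_nonneg zero_le_one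
    rw [hξ.rvLaplace_remotePart] at this
    simpa only [mul_one, neg_mul, one_mul] using this.symm
  set a := tailWeight lam n * ω₀
  set p := ∏ j ∈ Finset.Ico m n, φ (lam j)
  calc ∫ w, (1 - Real.exp (-remotePart lam ω₀ ξ n m w)) ∂P
      = (1 - Real.exp (-a)) + Real.exp (-a) * (1 - p) := by rw [integral_eq]; ring
    _ ≤ a + (1 - p) := add_le_add (sub_le_comm.1 (Real.one_sub_le_exp_neg a))
        (mul_le_of_le_one_left (sub_nonneg.2 prod_le_one)
          (Real.exp_le_one_iff.2 (neg_nonpos.2 drift_nonneg)))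
    _ ≤ a + ∑ j ∈ Finset.Ico m n, (1 - φ (lam j)) := add_le_add_right
        (one_sub_prod_le_sum (fun j _ => rvLaplace_nonneg _) fun j _ => φ_le_one j) a
    _ ≤ mixingRate lam ω₀ φ m := add_le_add drift_le sum_le_tsum

theorem exists_integral_abs_sq_shiftedWeight_sub_le (hξ : IsNonnegNoise P ξ)
    (hlam : IsProbabilityWeight lam) (hsum : Summable fun n => 1 - rvLaplace P (ξ 1) (lam n))
    {F f : ℝ → ℝ} (hF : IsPolyLaplace F f) (hω₀ : 0 ≤ ω₀) {ε : ℝ} (hε : 0 < ε) :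
    ∃ C, ∀ m n, m ≤ n → ∫ w, |shiftedWeight f lam ω₀ ξ ε n w ^ 2 -
        laplaceTransform f (ε + |noiseSum lam ξ n (Finset.range m) w|) ^ 2| ∂P
      ≤ C * mixingRate lam ω₀ (rvLaplace P (ξ 1)) m := by
  obtain ⟨C, hC, sub_le⟩ := hF.exists_sq_laplaceTransform_sub_le hε
  refine ⟨C, fun m n hmn => ?_⟩
  have remote_meas : Measurable (remotePart lam ω₀ ξ n m) :=
    measurable_remotePart fun k hk _ => hξ.meas k hk
  have remote_nonneg : ∀ᵐ w ∂P, 0 ≤ remotePart lam ω₀ ξ n m w :=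
    hξ.ae_nonneg.mono fun w hw => remotePart_nonneg hlam hω₀ hw n m
  have bound_int : Integrable (fun w => 1 - Real.exp (-remotePart lam ω₀ ξ n m w)) P := by
    have exp_int := integrable_exp_neg_mul remote_meas remote_nonneg zero_le_one
    simp only [neg_one_mul] at exp_int
    exact (integrable_const 1).sub exp_int
  have pointwise : ∀ᵐ w ∂P, |shiftedWeight f lam ω₀ ξ ε n w ^ 2 -
      laplaceTransform f (ε + |noiseSum lam ξ n (Finset.range m) w|) ^ 2|
        ≤ C * (1 - Real.exp (-remotePart lam ω₀ ξ n m w)) := by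
    filter_upwards [hξ.ae_nonneg, remote_nonneg] with w noise_nonneg remote_nonneg
    have recent_nonneg := noiseSum_nonneg hlam noise_nonneg (Finset.range_mono hmn)
    rw [shiftedWeight, ← noiseSum_add_remotePart hmn w,
      abs_of_nonneg (add_nonneg recent_nonneg remote_nonneg), abs_of_nonneg recent_nonneg]
    exact sub_le _ _ recent_nonneg remote_nonneg
  refine (integral_mono_of_nonneg (ae_of_all _ fun w => abs_nonneg _) (bound_int.const_mul C)
    pointwise).trans ?_
  rw [integral_const_mul]
  exact mul_le_mul_of_nonneg_left
    (hξ.integral_one_sub_exp_remotePart_le hlam hsum hω₀ hmn) hC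

theorem exists_abs_covariance_sq_shiftedWeight_le (hξ : IsNonnegNoise P ξ)
    (hlam : IsProbabilityWeight lam) (hsum : Summable fun n => 1 - rvLaplace P (ξ 1) (lam n))
    {F f : ℝ → ℝ} (hF : IsPolyLaplace F f) (hω₀ : 0 ≤ ω₀) {ε : ℝ} (hε : 0 < ε) :
    ∃ C, ∀ i m, |cov[fun w => shiftedWeight f lam ω₀ ξ ε i w ^ 2,
        fun w => shiftedWeight f lam ω₀ ξ ε (i + m) w ^ 2; P]|
      ≤ C * mixingRate lam ω₀ (rvLaplace P (ξ 1)) m := by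
  obtain ⟨C, coupling_le⟩ :=
    hξ.exists_integral_abs_sq_shiftedWeight_sub_le hlam hsum hF hω₀ hε
  set K := laplaceTransform f ε
  let g (x : ℝ) : ℝ := laplaceTransform f (ε + |x|) ^ 2
  have g_meas : Measurable g :=
    (hF.measurable_laplaceTransform.comp (measurable_norm.const_add ε)).pow_const 2
  have g_le (x : ℝ) : |g x| ≤ K ^ 2 := by
    rw [abs_of_nonneg (sq_nonneg _)]
    have arg_ge : ε ≤ ε + |x| := le_add_of_nonneg_right (abs_nonneg x)
    exact pow_le_pow_left₀ (hF.laplaceTransform_nonneg _) (hF.antitoneOn_laplaceTransform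
      (Set.mem_Ioi.2 hε) (Set.mem_Ioi.2 (hε.trans_le arg_ge)) arg_ge) 2
  have g_memLp {X : Ω → ℝ} (hX : Measurable X) : MemLp (fun w => g (X w)) 2 P :=
    MemLp.of_bound (g_meas.comp hX).aestronglyMeasurable (K ^ 2) (ae_of_all _ fun w => g_le _)
  have average_meas (n : ℕ) : Measurable (movingAverage lam ω₀ ξ n) :=
    measurable_movingAverage fun k hk _ => hξ.meas k hk
  refine ⟨2 * K ^ 2 * C, fun i m => ?_⟩
  have recent_meas : Measurable (noiseSum lam ξ (i + m) (Finset.range m)) :=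
    measurable_noiseSum fun j hj => hξ.meas _ (by have := Finset.mem_range.1 hj; omega)
  refine (abs_covariance_le_of_indepFun (g_meas.comp (average_meas i)) (fun w => g_le _)
    (g_memLp (average_meas (i + m))) (g_memLp recent_meas)
    ((hξ.indepFun_movingAverage_noiseSum i m).comp g_meas g_meas)).trans ?_
  rw [mul_assoc _ C]
  exact mul_le_mul_of_nonneg_left (coupling_le m (i + m) (Nat.le_add_left m i)) (by positivity)

end IsNonnegNoise

end Mixing

section Convergence

variable {Ω : Type*} {mΩ : MeasurableSpace Ω} {P : Measure Ω} [IsProbabilityMeasure P]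
  {ξ e : ℕ → Ω → ℝ} {β c : ℝ} {lam : ℕ → ℝ} {ω₀ : ℝ} {F f : ℝ → ℝ}

namespace IsNonnegNoise

theorem ae_movingAverage_pos (hξ : IsNonnegNoise P ξ) (hφ : HasPowerDecay (rvLaplace P (ξ 1)) β c)
    (hlam : IsProbabilityWeight lam) (hω₀ : 0 < ω₀) :
    ∀ᵐ w ∂P, ∀ n, 0 < movingAverage lam ω₀ ξ n w :=
  (hξ.ae_pos (hφ.tendsto_zero rvLaplace_nonneg)).mono fun _ hw => movingAverage_pos hlam hω₀ hw

theorem memLp_and_integral_sq_shiftedWeight (hξ : IsNonnegNoise P ξ)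
    (hφ : HasPowerDecay (rvLaplace P (ξ 1)) β c) (hlam : IsProbabilityWeight lam)
    (hF : IsPolyLaplace F f) (hω₀ : 0 < ω₀)
    (hfin : (Function.support lam).Finite →
      IntegrableOn (varianceIntegrand f (rvLaplace P (ξ 1)) lam) (Set.Ioi 0))
    {ε : ℝ} (hε : 0 ≤ ε) (n : ℕ) :
    MemLp (shiftedWeight f lam ω₀ ξ ε n) 2 P ∧
      ∫ w, shiftedWeight f lam ω₀ ξ ε n w ^ 2 ∂P = ∫ t in Set.Ioi 0, Real.exp (-ε * t) *
        (selfConv f t * rvLaplace P (movingAverage lam ω₀ ξ n) t) := by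
  have average_pos := hξ.ae_movingAverage_pos hφ hlam hω₀
  have weight_ae_eq : (fun w => laplaceTransform f (ε + movingAverage lam ω₀ ξ n w))
      =ᵐ[P] shiftedWeight f lam ω₀ ξ ε n := by
    filter_upwards [average_pos] with w hw
    rw [shiftedWeight, abs_of_pos (hw n)]
  obtain ⟨memLp, integral_eq⟩ := hF.memLp_and_integral_sq_comp_const_add
    (measurable_movingAverage fun k hk _ => hξ.meas k hk) (average_pos.mono fun w hw => hw n)
    (hξ.integrableOn_selfConv_mul_rvLaplace hlam hF hω₀ hfin n) hε
  exact ⟨memLp.ae_eq weight_ae_eq,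
    (integral_congr_ae (weight_ae_eq.symm.fun_comp (· ^ 2))).trans integral_eq⟩

theorem tendsto_integral_sq_shiftedWeight (hξ : IsNonnegNoise P ξ)
    (hφ : HasPowerDecay (rvLaplace P (ξ 1)) β c) (hlam : IsProbabilityWeight lam)
    (hsum : Summable fun n => 1 - rvLaplace P (ξ 1) (lam n)) (hF : IsPolyLaplace F f)
    (hω₀ : 0 < ω₀)
    (hfin : (Function.support lam).Finite →
      IntegrableOn (varianceIntegrand f (rvLaplace P (ξ 1)) lam) (Set.Ioi 0))
    {ε : ℝ} (hε : 0 ≤ ε) :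
    Tendsto (fun n => ∫ w, shiftedWeight f lam ω₀ ξ ε n w ^ 2 ∂P) atTop
      (𝓝 (∫ t in Set.Ioi 0,
        Real.exp (-ε * t) * varianceIntegrand f (rvLaplace P (ξ 1)) lam t)) := by
  simp_rw [(hξ.memLp_and_integral_sq_shiftedWeight hφ hlam hF hω₀ hfin hε _).2]
  exact hξ.tendsto_integral_exp_mul_selfConv_mul_rvLaplace hφ hlam hsum hF hω₀ hfin hε

theorem integral_sq_shiftedWeight_sub_le (hξ : IsNonnegNoise P ξ)
    (hφ : HasPowerDecay (rvLaplace P (ξ 1)) β c) (hlam : IsProbabilityWeight lam)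
    (hF : IsPolyLaplace F f) (hω₀ : 0 < ω₀)
    (hfin : (Function.support lam).Finite →
      IntegrableOn (varianceIntegrand f (rvLaplace P (ξ 1)) lam) (Set.Ioi 0))
    {ε : ℝ} (hε : 0 ≤ ε) (n : ℕ) :
    ∫ w, (shiftedWeight f lam ω₀ ξ 0 n w - shiftedWeight f lam ω₀ ξ ε n w) ^ 2 ∂P
      ≤ ∫ w, shiftedWeight f lam ω₀ ξ 0 n w ^ 2 ∂P
        - ∫ w, shiftedWeight f lam ω₀ ξ ε n w ^ 2 ∂P := by
  have memLp_zero := (hξ.memLp_and_integral_sq_shiftedWeight hφ hlam hF hω₀ hfin le_rfl n).1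
  have memLp_shift := (hξ.memLp_and_integral_sq_shiftedWeight hφ hlam hF hω₀ hfin hε n).1
  rw [← integral_sub memLp_zero.integrable_sq memLp_shift.integrable_sq]
  refine integral_mono_ae (memLp_zero.sub memLp_shift).integrable_sq
    (memLp_zero.integrable_sq.sub memLp_shift.integrable_sq) ?_
  filter_upwards [hξ.ae_movingAverage_pos hφ hlam hω₀] with w hw
  have shift_nonneg : 0 ≤ shiftedWeight f lam ω₀ ξ ε n w := hF.laplaceTransform_nonneg _
  have shift_le : shiftedWeight f lam ω₀ ξ ε n w ≤ shiftedWeight f lam ω₀ ξ 0 n w := by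
    have average_pos : 0 < |movingAverage lam ω₀ ξ n w| := abs_pos.2 (hw n).ne'
    exact hF.antitoneOn_laplaceTransform (Set.mem_Ioi.2 (by linarith))
      (Set.mem_Ioi.2 (by linarith)) (by linarith)
  nlinarith

theorem tendsto_integral_abs_average_predictableVariation_shiftedWeight_sub
    (hξ : IsNonnegNoise P ξ) (hφ : HasPowerDecay (rvLaplace P (ξ 1)) β c)
    (hlam : IsProbabilityWeight lam) (hsum : Summable fun n => 1 - rvLaplace P (ξ 1) (lam n))
    (hF : IsPolyLaplace F f) (hω₀ : 0 < ω₀)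
    (hfin : (Function.support lam).Finite →
      IntegrableOn (varianceIntegrand f (rvLaplace P (ξ 1)) lam) (Set.Ioi 0))
    {v₀ : ℝ} (he : ∀ i, ∫ w, e i w ^ 2 ∂P ≤ v₀)
    (he_lim : Tendsto (fun i => ∫ w, e i w ^ 2 ∂P) atTop (𝓝 1)) {ε : ℝ} (hε : 0 < ε) :
    Tendsto (fun N : ℕ => ∫ w, |(N : ℝ)⁻¹ *
        predictableVariation P (shiftedWeight f lam ω₀ ξ ε) e N w -
          ∫ t in Set.Ioi 0, Real.exp (-ε * t) *
            varianceIntegrand f (rvLaplace P (ξ 1)) lam t| ∂P) atTop (𝓝 0) := by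
  obtain ⟨C, covariance_le⟩ :=
    hξ.exists_abs_covariance_sq_shiftedWeight_le hlam hsum hF hω₀.le hε
  have sq_memLp (i : ℕ) : MemLp (fun w => shiftedWeight f lam ω₀ ξ ε i w ^ 2) 2 P := by
    refine MemLp.of_bound ((measurable_shiftedWeight hF fun k hk _ =>
      hξ.meas k hk).pow_const 2).aestronglyMeasurable (laplaceTransform f ε ^ 2)
      (ae_of_all _ fun w => ?_)
    rw [norm_pow]
    exact pow_le_pow_left₀ (norm_nonneg _) (abs_shiftedWeight_le hF hε i w) 2
  refine tendsto_integral_abs_average_predictableVariation_sub sq_memLp he he_lim covariance_le ?_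
    (hξ.tendsto_integral_sq_shiftedWeight hφ hlam hsum hF hω₀ hfin hε.le)
  simpa only [mul_zero] using
    (hlam.tendsto_mixingRate (ω₀ := ω₀) (rvLaplace P (ξ 1))).const_mul C

theorem tendsto_integral_exp_weightedSum_shiftedWeight (hξ : IsNonnegNoise P ξ)
    (hφ : HasPowerDecay (rvLaplace P (ξ 1)) β c) (hlam : IsProbabilityWeight lam)
    (hsum : Summable fun n => 1 - rvLaplace P (ξ 1) (lam n)) (hF : IsPolyLaplace F f)
    (hω₀ : 0 < ω₀)
    (hfin : (Function.support lam).Finite →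
      IntegrableOn (varianceIntegrand f (rvLaplace P (ξ 1)) lam) (Set.Ioi 0))
    {𝓕 : Filtration ℕ mΩ} (hξ𝓕 : ∀ n k, 1 ≤ k → k ≤ n → Measurable[𝓕 n] (ξ k))
    (he : IsInnovation 𝓕 P e) {q M : ℝ} (hM : HasMomentBound P e q M) (hq2 : 2 < q) (hq3 : q ≤ 3)
    (he_lim : Tendsto (fun i => ∫ w, e i w ^ 2 ∂P) atTop (𝓝 1)) (u : ℝ) :
    Tendsto (fun N : ℕ => ∫ w, Complex.exp ((u * ((√(N : ℝ))⁻¹ *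
        weightedSum (shiftedWeight f lam ω₀ ξ 0) e N w) : ℝ) * Complex.I) ∂P) atTop
      (𝓝 ((Real.exp (-(u ^ 2 * limitVariance f (rvLaplace P (ξ 1)) lam / 2)) : ℝ) : ℂ)) := by
  set V := limitVariance f (rvLaplace P (ξ 1)) lam
  have weight_meas (ε : ℝ) (i : ℕ) : Measurable[𝓕 i] (shiftedWeight f lam ω₀ ξ ε i) :=
    measurable_shiftedWeight hF (hξ𝓕 i)
  have variance_tendsto : Tendsto (fun ε => ∫ t in Set.Ioi 0,
      Real.exp (-ε * t) * varianceIntegrand f (rvLaplace P (ξ 1)) lam t) (𝓝[>] 0) (𝓝 V) :=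
    tendsto_setIntegral_exp_neg_mul (hξ.integrableOn_varianceIntegrand hφ hlam hsum hF hfin)
  have sq_tendsto := hξ.tendsto_integral_sq_shiftedWeight hφ hlam hsum hF hω₀ hfin le_rfl
  simp only [neg_zero, zero_mul, Real.exp_zero, one_mul] at sq_tendsto
  have eventually_pos : ∀ᶠ ε : ℝ in 𝓝[>] 0, 0 < ε := eventually_mem_nhdsWithin
  refine he.tendsto_integral_exp_weightedSum_of_approx hM hq2 hq3 (weight_meas 0)
    (fun i => (hξ.memLp_and_integral_sq_shiftedWeight hφ hlam hF hω₀ hfin le_rfl i).1)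
    (Eventually.of_forall weight_meas)
    (eventually_pos.mono fun ε hε => abs_shiftedWeight_le hF hε)
    (eventually_pos.mono fun ε hε =>
      hξ.tendsto_integral_abs_average_predictableVariation_shiftedWeight_sub hφ hlam hsum hF hω₀
        hfin (fun i => hM.integral_sq_le hq2.le (he.memLp_two i)) he_lim hε)
    variance_tendsto
    (eventually_pos.mono fun ε hε =>
      hξ.integral_sq_shiftedWeight_sub_le hφ hlam hF hω₀ hfin hε.le)
    (eventually_pos.mono fun ε hε => sq_tendsto.sub
      (hξ.tendsto_integral_sq_shiftedWeight hφ hlam hsum hF hω₀ hfin hε.le)) ?_ u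
  have gap_tendsto := variance_tendsto.const_sub V
  rwa [sub_self] at gap_tendsto

end IsNonnegNoise

end Convergence

section History

variable {Ω : Type*} {mΩ : MeasurableSpace Ω}

/-- The filtration whose `σ`-algebra at time `n` is generated by `X 1, …, X n`. -/
def historyFiltration {E : Type*} [MeasurableSpace E] (X : ℕ → Ω → E)
    (hX : ∀ n, 1 ≤ n → Measurable (X n)) : Filtration ℕ mΩ where
  seq n := MeasurableSpace.comap (fun w => fun k : Finset.Icc 1 n => X k w) inferInstance
  mono' m n hmn := by
    have restrict_meas := Finset.measurable_restrict₂ (X := fun _ : ℕ => E)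
      (Finset.Icc_subset_Icc_right hmn : Finset.Icc 1 m ⊆ Finset.Icc 1 n)
    exact (restrict_meas.comp (comap_measurable fun w => fun k : Finset.Icc 1 n => X k w)).comap_le
  le' n := (measurable_pi_lambda (fun w => fun k : Finset.Icc 1 n => X k w) fun k =>
    hX k.1 (Finset.mem_Icc.1 k.2).1).comap_le

theorem measurable_historyFiltration {E : Type*} [MeasurableSpace E] {X : ℕ → Ω → E}
    (hX : ∀ n, 1 ≤ n → Measurable (X n)) {n k : ℕ} (hk : 1 ≤ k) (hkn : k ≤ n) :
    Measurable[historyFiltration X hX n] (X k) :=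
  (measurable_pi_apply (⟨k, Finset.mem_Icc.2 ⟨hk, hkn⟩⟩ : Finset.Icc 1 n)).comp
    (comap_measurable fun w => fun k : Finset.Icc 1 n => X k w)

variable {P : Measure Ω} {ξ η : ℕ → Ω → ℝ}

theorem isInnovation_historyFiltration
    (hmeas : ∀ n, 1 ≤ n → Measurable fun w => (ξ n w, η n w))
    (hindep : ∀ n : ℕ, IndepFun (η (n + 1))
      (fun w => fun k : Finset.Icc 1 n => ((ξ k w, η k w) : ℝ × ℝ)) P)
    (hmean : ∀ n, 1 ≤ n → ∫ w, η n w ∂P = 0) (hmemLp : ∀ i, MemLp (η (i + 1)) 2 P) :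
    IsInnovation (historyFiltration (fun n w => (ξ n w, η n w)) hmeas) P fun i => η (i + 1) where
  measurable_succ i :=
    measurable_snd.comp (measurable_historyFiltration hmeas (Nat.le_add_left 1 i) le_rfl)
  indep i := ((IndepFun_iff_Indep _ _ _).1 (hindep i)).symm
  memLp_two := hmemLp
  integral_eq_zero i := hmean (i + 1) (Nat.le_add_left 1 i)

theorem hasMomentBound_of_iSup_lintegral_lt_top [IsProbabilityMeasure P] {e : ℕ → Ω → ℝ}
    (he : ∀ i, Measurable (e i)) {p q : ℝ} (hq : 0 ≤ q) (hqp : q ≤ p)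
    (hp : (⨆ i, ∫⁻ w, ENNReal.ofReal (|e i w| ^ p) ∂P) < ⊤) :
    HasMomentBound P e q (1 + ⨆ i, ∫⁻ w, ENNReal.ofReal (|e i w| ^ p) ∂P).toReal := by
  set B := ⨆ i, ∫⁻ w, ENNReal.ofReal (|e i w| ^ p) ∂P
  have rpow_le (x : ℝ) : |x| ^ q ≤ 1 + |x| ^ p := by
    rcases le_total |x| 1 with h | h
    · exact (Real.rpow_le_one (abs_nonneg x) h hq).trans
        (le_add_of_nonneg_right (Real.rpow_nonneg (abs_nonneg x) p))
    · exact (Real.rpow_le_rpow_of_exponent_le h hqp).trans (le_add_of_nonneg_left zero_le_one)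
  have lintegral_le (i : ℕ) : ∫⁻ w, ENNReal.ofReal (|e i w| ^ q) ∂P ≤ 1 + B := by
    calc ∫⁻ w, ENNReal.ofReal (|e i w| ^ q) ∂P
        ≤ ∫⁻ w, (1 + ENNReal.ofReal (|e i w| ^ p)) ∂P := lintegral_mono fun w => by
          rw [← ENNReal.ofReal_one, ← ENNReal.ofReal_add zero_le_one (by positivity)]
          exact ENNReal.ofReal_le_ofReal (rpow_le _)
      _ = 1 + ∫⁻ w, ENNReal.ofReal (|e i w| ^ p) ∂P := by
          rw [lintegral_add_left measurable_const, lintegral_const, measure_univ, mul_one]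
      _ ≤ 1 + B := by
          gcongr
          exact le_iSup (fun i => ∫⁻ w, ENNReal.ofReal (|e i w| ^ p) ∂P) i
  have bound_lt_top : 1 + B < ⊤ := ENNReal.add_lt_top.2 ⟨ENNReal.one_lt_top, hp⟩
  have rpow_nonneg (i : ℕ) : 0 ≤ᵐ[P] fun w => |e i w| ^ q := ae_of_all _ fun w => by positivity
  have rpow_meas (i : ℕ) : AEStronglyMeasurable (fun w => |e i w| ^ q) P :=
    ((he i).norm.pow_const q).aestronglyMeasurable
  exact ⟨fun i => ⟨rpow_meas i, (hasFiniteIntegral_iff_ofReal (rpow_nonneg i)).2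
      ((lintegral_le i).trans_lt bound_lt_top)⟩,
    fun i => (integral_eq_lintegral_of_nonneg_ae (rpow_nonneg i) (rpow_meas i)).trans_le
      (ENNReal.toReal_mono bound_lt_top.ne (lintegral_le i))⟩

end History

section MainTheorem

variable {Ω : Type*} {mΩ : MeasurableSpace Ω} {P : Measure Ω} [IsProbabilityMeasure P]

theorem tendstoInDistribution_gaussianReal_of_tendsto_integral_exp {S : ℕ → Ω → ℝ}
    (hS : ∀ N, AEMeasurable (S N) P) {V : ℝ} (hV : 0 ≤ V)
    (h : ∀ u : ℝ, Tendsto (fun N => ∫ w, Complex.exp ((u * S N w : ℝ) * Complex.I) ∂P) atTop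
      (𝓝 ((Real.exp (-(u ^ 2 * V / 2)) : ℝ) : ℂ))) :
    TendstoInDistribution S atTop (id : ℝ → ℝ) (fun _ => P) (gaussianReal 0 V.toNNReal) := by
  refine ⟨hS, aemeasurable_id, ProbabilityMeasure.tendsto_iff_tendsto_charFun.2 fun u => ?_⟩
  have charFun_gaussian : charFun ((gaussianReal 0 V.toNNReal).map (id : ℝ → ℝ)) u
      = ((Real.exp (-(u ^ 2 * V / 2)) : ℝ) : ℂ) := by
    rw [Measure.map_id, charFun_gaussianReal, Complex.ofReal_exp]
    congr 1
    rw [← Complex.coe_algebraMap, Real.coe_toNNReal V hV]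
    push_cast
    ring
  simp only [ProbabilityMeasure.coe_mk]
  rw [charFun_gaussian]
  refine (h u).congr fun N => ?_
  rw [charFun_apply_real, integral_map (hS N) (by fun_prop)]
  push_cast
  rfl

variable {lam : ℕ → ℝ} {ξ η : ℕ → Ω → ℝ} {β c ω₀ : ℝ} {F f : ℝ → ℝ}

theorem weightedSum_shiftedWeight_zero_eq (hF : IsPolyLaplace F f) {w : Ω}
    (hw : ∀ n, 0 < movingAverage lam ω₀ ξ n w) (N : ℕ) :
    weightedSum (shiftedWeight f lam ω₀ ξ 0) (fun i => η (i + 1)) N w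
      = ∑ k ∈ Finset.Icc 1 N, F (movingAverage lam ω₀ ξ (k - 1) w) * η k w := by
  rw [weightedSum, Finset.range_eq_Ico, ← Finset.Ico_add_one_right_eq_Icc,
    ← Finset.sum_Ico_add' _ 0 N 1]
  refine Finset.sum_congr rfl fun i _ => ?_
  rw [Nat.add_sub_cancel, shiftedWeight, zero_add, abs_of_pos (hw i), hF.eq_laplace _ (hw i)]

theorem IsProbabilityWeight.summable_one_sub_of_one_sub_rpow_le (hlam : IsProbabilityWeight lam)
    {γ : ℝ} (hγ : γ ∈ Set.Ioo (0 : ℝ) 1)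
    (hdecay : BddAbove (Set.range fun n : ℕ => (γ ^ n)⁻¹ * lam n)) {φ : ℝ → ℝ} {α : ℝ} (hα : 0 < α)
    (hφ_le_one : ∀ t, 0 ≤ t → φ t ≤ 1) (hφ : ∀ t : ℝ, 0 ≤ t → 1 - t ^ α ≤ φ t) :
    Summable fun n => 1 - φ (lam n) := by
  obtain ⟨C, hC⟩ := hdecay
  have lam_le (n : ℕ) : lam n ≤ C * γ ^ n := by
    rw [mul_comm, ← inv_mul_le_iff₀ (pow_pos hγ.1 n)]
    exact hC ⟨n, rfl⟩
  have C_nonneg : 0 ≤ C := by simpa using (hlam.nonneg 0).trans (lam_le 0)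
  have geometric_summable : Summable fun n : ℕ => C ^ α * (γ ^ α) ^ n :=
    (summable_geometric_of_lt_one (Real.rpow_nonneg hγ.1.le _)
      (Real.rpow_lt_one hγ.1.le hγ.2 hα)).mul_left _
  refine geometric_summable.of_nonneg_of_le
    (fun n => sub_nonneg.2 (hφ_le_one _ (hlam.nonneg n))) fun n => ?_
  calc 1 - φ (lam n) ≤ lam n ^ α := sub_le_comm.1 (hφ _ (hlam.nonneg n))
    _ ≤ (C * γ ^ n) ^ α := Real.rpow_le_rpow (hlam.nonneg n) (lam_le n) hα.le
    _ = C ^ α * (γ ^ α) ^ n := by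
        rw [Real.mul_rpow C_nonneg (pow_nonneg hγ.1.le n), Real.rpow_pow_comm hγ.1.le]

theorem limitVariance_nonneg {φ : ℝ → ℝ} (hf : ∀ t, 0 < t → 0 ≤ f t) (hφ : ∀ t, 0 ≤ φ t) :
    0 ≤ limitVariance f φ lam :=
  setIntegral_nonneg measurableSet_Ioi fun _ ht =>
    mul_nonneg (selfConv_nonneg hf (Set.mem_Ioi.1 ht).le) (tprod_nonneg fun _ => hφ _)

theorem IsNonnegNoise.tendstoInDistribution_weightedSum_shiftedWeight (hξ : IsNonnegNoise P ξ)
    (hφ : HasPowerDecay (rvLaplace P (ξ 1)) β c) (hlam : IsProbabilityWeight lam)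
    (hsum : Summable fun n => 1 - rvLaplace P (ξ 1) (lam n)) (hF : IsPolyLaplace F f)
    (hω₀ : 0 < ω₀)
    (hfin : (Function.support lam).Finite →
      IntegrableOn (varianceIntegrand f (rvLaplace P (ξ 1)) lam) (Set.Ioi 0))
    {𝓕 : Filtration ℕ mΩ} (hξ𝓕 : ∀ n k, 1 ≤ k → k ≤ n → Measurable[𝓕 n] (ξ k)) {e : ℕ → Ω → ℝ}
    (he : IsInnovation 𝓕 P e) {q M : ℝ} (hM : HasMomentBound P e q M) (hq2 : 2 < q) (hq3 : q ≤ 3)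
    (he_lim : Tendsto (fun i => ∫ w, e i w ^ 2 ∂P) atTop (𝓝 1)) :
    TendstoInDistribution
      (fun (N : ℕ) w => (√(N : ℝ))⁻¹ * weightedSum (shiftedWeight f lam ω₀ ξ 0) e N w)
      atTop (id : ℝ → ℝ) (fun _ => P)
      (gaussianReal 0 (limitVariance f (rvLaplace P (ξ 1)) lam).toNNReal) := by
  have sum_meas (N : ℕ) : Measurable (weightedSum (shiftedWeight f lam ω₀ ξ 0) e N) :=
    (he.measurable_weightedSum (fun i => measurable_shiftedWeight hF (hξ𝓕 i)) N).mono
      (𝓕.le N) le_rfl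
  exact tendstoInDistribution_gaussianReal_of_tendsto_integral_exp
    (fun N => ((sum_meas N).const_mul _).aemeasurable)
    (limitVariance_nonneg hF.nonneg_right rvLaplace_nonneg) fun u =>
    hξ.tendsto_integral_exp_weightedSum_shiftedWeight hφ hlam hsum hF hω₀ hfin hξ𝓕 he hM hq2 hq3
      he_lim u

theorem mainTheorem2_general (hlam : IsProbabilityWeight lam) (hξ : IsNonnegNoise P ξ)
    (hφ : HasPowerDecay (rvLaplace P (ξ 1)) β c)
    (hsum : Summable fun n => 1 - rvLaplace P (ξ 1) (lam n)) (hF : IsPolyLaplace F f)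
    (hfin : (Function.support lam).Finite →
      IntegrableOn (varianceIntegrand f (rvLaplace P (ξ 1)) lam) (Set.Ioi 0))
    (hω₀ : 0 < ω₀) (hη_meas : ∀ n, 1 ≤ n → Measurable (η n))
    (hη_indep : ∀ n : ℕ, IndepFun (η (n + 1))
      (fun w => fun k : Finset.Icc 1 n => ((ξ k w, η k w) : ℝ × ℝ)) P)
    (hη_mean : ∀ n, 1 ≤ n → ∫ w, η n w ∂P = 0)
    (hη_var : Tendsto (fun n : ℕ => ∫ w, (η n w) ^ 2 ∂P) atTop (𝓝 1)) {p : ℝ} (hp : 2 < p)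
    (hη_moment : (⨆ n : ℕ, ∫⁻ w, ENNReal.ofReal (|η (n + 1) w| ^ p) ∂P) < ⊤) :
    IntegrableOn (varianceIntegrand f (rvLaplace P (ξ 1)) lam) (Set.Ioi 0) ∧
    TendstoInDistribution
      (fun (N : ℕ) (w : Ω) =>
        (√(N : ℝ))⁻¹ * ∑ k ∈ Finset.Icc 1 N, F (movingAverage lam ω₀ ξ (k - 1) w) * η k w)
      atTop (id : ℝ → ℝ) (fun _ => P)
      (gaussianReal 0 (limitVariance f (rvLaplace P (ξ 1)) lam).toNNReal) := by
  refine ⟨hξ.integrableOn_varianceIntegrand hφ hlam hsum hF hfin, ?_⟩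
  have innovation_meas (i : ℕ) : Measurable (η (i + 1)) := hη_meas _ (Nat.le_add_left 1 i)
  have pair_meas (n : ℕ) (hn : 1 ≤ n) : Measurable fun w => (ξ n w, η n w) :=
    (hξ.meas n hn).prodMk (hη_meas n hn)
  have moment_bound {q : ℝ} (hq : 0 ≤ q) (hqp : q ≤ p) :=
    hasMomentBound_of_iSup_lintegral_lt_top innovation_meas hq hqp hη_moment
  have innovation_memLp (i : ℕ) : MemLp (η (i + 1)) 2 P :=
    (memLp_two_iff_integrable_sq (innovation_meas i).aestronglyMeasurable).2
      (by simpa using (moment_bound zero_le_two hp.le).integrable i)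
  have innovation := isInnovation_historyFiltration pair_meas hη_indep hη_mean innovation_memLp
  refine TendstoInDistribution.congr (fun N => ?_) (EventuallyEq.refl _ _)
    (hξ.tendstoInDistribution_weightedSum_shiftedWeight hφ hlam hsum hF hω₀ hfin
      (fun n k hk hkn => measurable_fst.comp (measurable_historyFiltration pair_meas hk hkn))
      innovation (moment_bound (q := min p 3) (by positivity) (min_le_left _ _))
      (lt_min hp (by norm_num)) (min_le_right _ _) ((tendsto_add_atTop_iff_nat 1).2 hη_var))
  filter_upwards [hξ.ae_movingAverage_pos hφ hlam hω₀] with w hw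
  rw [weightedSum_shiftedWeight_zero_eq hF hw]

end MainTheorem

theorem mainTheorem2 {Ω : Type*} [MeasurableSpace Ω] (P : Measure Ω) [IsProbabilityMeasure P]
    -- the weights
    (lam : ℕ → ℝ) (hlam_nonneg : ∀ n, 0 ≤ lam n) (hlam_sum : HasSum lam 1)
    (γ : ℝ) (hγ : γ ∈ Set.Ioo (0 : ℝ) 1)
    (hlam_decay : BddAbove (Set.range fun n : ℕ => (γ ^ n)⁻¹ * lam n))
    -- the i.i.d. nonnegative sequence `ξ₁, ξ₂, …` (the value at index `0` is not used)
    (ξ : ℕ → Ω → ℝ) (hξ_meas : ∀ n, 1 ≤ n → Measurable (ξ n))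
    (hξ_nonneg : ∀ n, 1 ≤ n → ∀ᵐ w ∂P, 0 ≤ ξ n w)
    (hξ_indep : iIndepFun (fun n : ℕ => ξ (n + 1)) P)
    (hξ_ident : ∀ n, 1 ≤ n → IdentDistrib (ξ n) (ξ 1) P P)
    (α β c : ℝ) (hα : 0 < α) (hα' : α ≤ 1) (hβ : 0 < β) (hc : 0 < c)
    (hφ_lower : ∀ t : ℝ, 0 ≤ t → 1 - t ^ α ≤ rvLaplace P (ξ 1) t)
    (hφ_upper : ∀ t : ℝ, 0 ≤ t → rvLaplace P (ξ 1) t ≤ c * (1 + t) ^ (-β))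
    -- the function `F` and its inverse Laplace transform `f`
    (F f : ℝ → ℝ) (hF : IsPolyLaplace F f)
    -- only when finitely many weights are nonzero: the limiting variance is finite
    (hfin : (Function.support lam).Finite →
      IntegrableOn (varianceIntegrand f (rvLaplace P (ξ 1)) lam) (Set.Ioi 0))
    (ω₀ : ℝ) (hω₀ : 0 < ω₀)
    -- the innovations `η₁, η₂, …` (the value at index `0` is not used)
    (η : ℕ → Ω → ℝ) (hη_meas : ∀ n, 1 ≤ n → Measurable (η n))
    (hη_indep : ∀ n : ℕ, IndepFun (η (n + 1))
      (fun w => fun k : Finset.Icc 1 n => ((ξ k w, η k w) : ℝ × ℝ)) P)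
    (hη_mean : ∀ n, 1 ≤ n → ∫ w, η n w ∂P = 0)
    (hη_var : Tendsto (fun n : ℕ => ∫ w, (η n w) ^ 2 ∂P) atTop (𝓝 1))
    (p : ℝ) (hp : 2 < p)
    (hη_moment : (⨆ n : ℕ, ∫⁻ w, ENNReal.ofReal (|η (n + 1) w| ^ p) ∂P) < (⊤ : ENNReal)) :
    IntegrableOn (varianceIntegrand f (rvLaplace P (ξ 1)) lam) (Set.Ioi 0) ∧
    TendstoInDistribution
      (fun (N : ℕ) (w : Ω) =>
        (√(N : ℝ))⁻¹ * ∑ k ∈ Finset.Icc 1 N, F (movingAverage lam ω₀ ξ (k - 1) w) * η k w)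
      atTop (id : ℝ → ℝ) (fun _ => P)
      (gaussianReal 0 (limitVariance f (rvLaplace P (ξ 1)) lam).toNNReal) := by
  have hlam : IsProbabilityWeight lam := ⟨hlam_nonneg, hlam_sum⟩
  have hξ : IsNonnegNoise P ξ := ⟨hξ_meas, hξ_nonneg, hξ_indep, hξ_ident⟩
  exact mainTheorem2_general hlam hξ ⟨hβ, hφ_upper⟩
    (hlam.summable_one_sub_of_one_sub_rpow_le hγ hlam_decay hα (fun _ => rvLaplace_le_one
      (hξ_meas 1 le_rfl) (hξ_nonneg 1 le_rfl)) hφ_lower)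
    hF hfin hω₀ hη_meas hη_indep hη_mean hη_var hp hη_moment
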